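/- **Setting.** Let $d\ge 2$. A network $C=(c_{ij})_{i,j=1}^d$ is a symmetric real matrix with $c_{ij}\ge 0$ and $c_{ii}=0$. It is connected if the graph on $\{1,\dots,d\}$ whose edges are the pairs with $c_{ij}>0$ is connected, and it has unit total weight if $\sum_{i,j=1}^d c_{ij}=1$. Put $c_i=\sum_{j} c_{ij}$, $D=\mathrm{diag}(c_1,\dots,c_d)$ and $\Delta=I-D^{-1}C$. If $C$ is connected, $\Delta$ has $d$ real eigenvalues $0=\lambda_1<\lambda_2\le\dots\le\lambda_d\le 2$ (with multiplicity), and we write $$\lambda=\lambda_2,\qquad \gamma=\max(|1-\lambda_2|,|1-\lambda_d|),\qquad \beta=\min_i c_i .$$ For $A>0$ let $\pi_{A,C}$ be the probability measure on $[0,1]^d$ with Lebesgue density proportional to $\exp\{-A^2\sum_{i<j}c_{ij}(p_i-p_j)^2\}$. The coordinate Gibbs sampler for $\pi_{A,C}$ is the Markov chain on $[0,1]^d$ which at each step chooses $i\in\{1,\dots,d\}$ uniformly at random and resamples the $i$-th coordinate from its conditional distribution under $\pi_{A,C}$ given the other coordinates. Let $K_{A,C}^{*k}(\mathbf p)$ be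 its law after $k$ steps started from $\mathbf p$. For Borel probability measures $\mu,\nu$ on $[0,1]^d$ let $$d_\infty(\mu,\nu)=\min_{\mathbf p\sim\mu,\ \mathbf q\sim\nu}\mathbb E\,\|\mathbf p-\mathbf q\|_\infty,$$ the minimum being over all couplings of $\mu$ and $\nu$. **Theorem.** For every $\delta>0$ there are constants $m=m(\delta)>0$ and $M=M(\delta)>0$, depending only on $\delta$, and a threshold $A^*=A^*(\delta,\beta,\lambda)$, depending only on $\delta,\beta,\lambda$, such that for every $d\ge 2$, every connected network $C$ on $d$ vertices with unit total weight, every $A>0$ with $A\ge A^*(\delta,\beta,\lambda)$, and every integer $k\ge 0$: * if $k\le m\,\frac{\lambda}{\gamma}A^2$, then $\displaystyle\sup_{\mathbf p\in[0,1]^d} d_\infty\big(K_{A,C}^{*k}(\mathbf p),\pi_{A,C}\big)\ge \tfrac14-\delta$; * if $k\ge M d A^2$, then $\displaystyle\sup_{\mathbf p\in[0,1]^d} d_\infty\big(K_{A,C}^{*k}(\mathbf p),\pi_{A,C}\big)\le \delta$. -/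

import Mathlib

open MeasureTheory ProbabilityTheory
open scoped unitInterval ENNReal

namespace GibbsNetwork

/-- A network on the vertex set `[d]`: a symmetric matrix of non-negative weights, no loops. -/
structure Network (d : ℕ) where
  weight : Matrix (Fin d) (Fin d) ℝ
  symm : ∀ i j, weight i j = weight j i
  nonneg : ∀ i j, 0 ≤ weight i j
  no_loops : ∀ i, weight i i = 0

namespace Network

variable {d : ℕ} (C : Network d)

/-- The graph whose edges are the pairs of positive weight. -/
def graph : SimpleGraph (Fin d) where
  Adj i j := 0 < C.weight i j
  symm := ⟨fun i j h => by rw [C.symm j i]; exact h⟩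
  loopless := ⟨fun i h => by rw [C.no_loops i] at h; exact lt_irrefl _ h⟩

/-- The network is connected: any two vertices are joined by a path of positive weights. -/
def IsConnected : Prop := C.graph.Connected

/-- The sum of all the entries of the weight matrix is one. -/
def UnitTotalWeight : Prop := ∑ i, ∑ j, C.weight i j = 1

/-- The vertex weights `c_i = ∑_{j ≠ i} c_{ij}` (the diagonal entries vanish). -/
noncomputable def vertexWeight (i : Fin d) : ℝ := ∑ j, C.weight i j

/-- The network Laplacian `Δ = I - D⁻¹ C`, where `D = diag (c_1, …, c_d)`. -/
noncomputable def laplacian : Matrix (Fin d) (Fin d) ℝ :=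
  1 - Matrix.diagonal (fun i => (C.vertexWeight i)⁻¹) * C.weight

/-- The real eigenvalues `λ_1 ≤ λ_2 ≤ …` of the Laplacian, listed in increasing order and repeated
according to multiplicity. For a connected network, `Δ` is self-adjoint for the inner product
`∑ i, c_i p_i q_i`, so that there are exactly `d` of them. -/
noncomputable def eigenvalues : List ℝ := C.laplacian.charpoly.roots.sort (· ≤ ·)

/-- The spectral gap `λ = λ_2` (list entries are counted from `0`). -/
noncomputable def gap : ℝ := C.eigenvalues.getD 1 0

/-- The largest eigenvalue `λ_d` (list entries are counted from `0`). -/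
noncomputable def top : ℝ := C.eigenvalues.getD (d - 1) 0

/-- `γ = max (|1 - λ_2|, |1 - λ_d|)`. -/
noncomputable def gam : ℝ := max |1 - C.gap| |1 - C.top|

/-- `β = min_i c_i`. -/
noncomputable def beta : ℝ := ⨅ i, C.vertexWeight i

/-- The energy `∑_{i < j} c_{ij} (p_i - p_j)²`. -/
noncomputable def energy (p : Fin d → I) : ℝ :=
  ∑ i, ∑ j ∈ Finset.Ioi i, C.weight i j * ((p i : ℝ) - (p j : ℝ)) ^ 2

/-- The probability measure `π_{A,C}` on the cube `[0,1]^d` whose density with respect to Lebesgue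
measure is `Z⁻¹ exp (-A² ∑_{i < j} c_{ij} (p_i - p_j)²)`. -/
noncomputable def target (A : ℝ) : Measure (Fin d → I) :=
  (volume : Measure (Fin d → I)).tilted (fun p => -A ^ 2 * C.energy p)

/-- The conditional distribution under `π_{A,C}` of the `i`-th coordinate given the others: the
probability measure on `[0,1]` whose density at `x` is proportional to the joint density at
`(p_1, …, p_{i-1}, x, p_{i+1}, …, p_d)`. -/
noncomputable def condLaw (A : ℝ) (i : Fin d) (p : Fin d → I) : Measure I :=
  (volume : Measure I).tilted (fun x => -A ^ 2 * C.energy (Function.update p i x))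

lemma continuous_energy : Continuous C.energy := by
  unfold energy; fun_prop

lemma isProbabilityMeasure_target (A : ℝ) : IsProbabilityMeasure (C.target A) := by
  refine isProbabilityMeasure_tilted ?_
  have h : Continuous fun p => Real.exp (-A ^ 2 * C.energy p) := by
    have := C.continuous_energy
    fun_prop
  exact h.integrable_of_hasCompactSupport (HasCompactSupport.of_compactSpace _)

lemma isProbabilityMeasure_condLaw (A : ℝ) (i : Fin d) (p : Fin d → I) :
    IsProbabilityMeasure (C.condLaw A i p) := by
  refine isProbabilityMeasure_tilted ?_
  have h : Continuous fun x : I => Real.exp (-A ^ 2 * C.energy (Function.update p i x)) := by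
    have := C.continuous_energy
    fun_prop
  exact h.integrable_of_hasCompactSupport (HasCompactSupport.of_compactSpace _)

lemma measurable_condLaw_map (A : ℝ) (i : Fin d) :
    Measurable fun p : Fin d → I => (C.condLaw A i p).map (Function.update p i) := by
  have hu : Measurable fun q : (Fin d → I) × I => Function.update q.1 i q.2 :=
    (continuous_fst.update i continuous_snd).measurable
  have hf : Measurable fun q : (Fin d → I) × I =>
      Real.exp (-A ^ 2 * C.energy (Function.update q.1 i q.2)) :=
    Real.measurable_exp.comp ((C.continuous_energy.measurable.comp hu).const_mul _)
  have hZ : Measurable fun p : Fin d → I =>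
      ∫ x : I, Real.exp (-A ^ 2 * C.energy (Function.update p i x)) :=
    (hf.stronglyMeasurable.integral_prod_right).measurable
  refine Measure.measurable_of_measurable_coe _ fun s hs => ?_
  have key : ∀ p : Fin d → I, (C.condLaw A i p).map (Function.update p i) s =
      ∫⁻ x : I, (Prod.mk p ⁻¹' ((fun q : (Fin d → I) × I => Function.update q.1 i q.2) ⁻¹' s)).indicator
        (fun x => ENNReal.ofReal (Real.exp (-A ^ 2 * C.energy (Function.update p i x)) /
          ∫ y : I, Real.exp (-A ^ 2 * C.energy (Function.update p i y)))) x := by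
    intro p
    have hs' : MeasurableSet (Function.update p i ⁻¹' s) := measurable_update p hs
    rw [Measure.map_apply (measurable_update p) hs, condLaw, tilted_apply' _ _ hs']
    exact (lintegral_indicator hs' _).symm
  simp_rw [key]
  have hm : Measurable fun q : (Fin d → I) × I =>
      ((fun q : (Fin d → I) × I => Function.update q.1 i q.2) ⁻¹' s).indicator
        (fun q => ENNReal.ofReal (Real.exp (-A ^ 2 * C.energy (Function.update q.1 i q.2)) /
          ∫ y : I, Real.exp (-A ^ 2 * C.energy (Function.update q.1 i y)))) q :=
    ((hf.div (hZ.comp measurable_fst)).ennreal_ofReal).indicator (hu hs)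
  exact hm.lintegral_prod_right'

/-- One step of the coordinate Gibbs sampler: choose `i` uniformly in `[d]`, then resample the
`i`-th coordinate from its conditional distribution under `π_{A,C}` given the other ones. -/
noncomputable def gibbs (A : ℝ) : Kernel (Fin d → I) (Fin d → I) where
  toFun p := ∑ i, (d : ℝ≥0∞)⁻¹ • (C.condLaw A i p).map (Function.update p i)
  measurable' := by
    refine Measure.measurable_of_measurable_coe _ fun s hs => ?_
    simp only [Measure.coe_finsetSum, Finset.sum_apply, Measure.smul_apply, smul_eq_mul]
    exact Finset.measurable_sum _ fun i _ =>
      ((Measure.measurable_coe hs).comp (C.measurable_condLaw_map A i)).const_mul _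

/-- The law of the Gibbs sampler after `k` steps, started at `p`. -/
noncomputable def gibbsLaw (A : ℝ) (k : ℕ) (p : Fin d → I) : Measure (Fin d → I) :=
  (C.gibbs A ^ k) p

end Network

/-- The couplings of `μ` and `ν`: the measures on the product with these two marginals. -/
def couplings {d : ℕ} (μ ν : Measure (Fin d → I)) : Set (Measure ((Fin d → I) × (Fin d → I))) :=
  {ρ | ρ.map Prod.fst = μ ∧ ρ.map Prod.snd = ν}

/-- The `∞`-Wasserstein distance: the infimum (attained for probability measures) over all couplings of the expectation of
`‖p - q‖_∞ = sup_i |p_i - q_i|`, which is the distance of the product `[0,1]^d`. -/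
noncomputable def wassersteinInf {d : ℕ} (μ ν : Measure (Fin d → I)) : ℝ :=
  sInf ((fun ρ => ∫ z, dist z.1 z.2 ∂ρ) '' couplings μ ν)

/-- The worst-case distance to stationarity after `k` steps. -/
noncomputable def worstDist {d : ℕ} (C : Network d) (A : ℝ) (k : ℕ) : ℝ :=
  ⨆ p : Fin d → I, wassersteinInf (C.gibbsLaw A k p) (C.target A)

end GibbsNetwork

/-! The slow variable is the weighted mean S(p) = ∑ c_i p_i. Given the other coordinates, coordinate
i is a Gaussian of variance 1/(2A²c_i) centred at the weighted average of its neighbours and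
conditioned on [0,1] (`condLaw_eq`). By symmetry of the weights, averaging over neighbours preserves
S, so without the conditioning S would be a martingale. Conditioning adds a drift that is tiny when
the local means are away from 0 and 1, and that otherwise, in the directions that matter, is bounded
by the dissipation ∑ c_i (p_i - neighbour mean)² (`drift_mul_le`). One step lowers the energy by
dissipation/d, up to 1/(2A²) (`markovOp_gibbs_energy_le`); adding a suitable multiple of the energy
to a test function therefore pays for such errors.

Lower bound: from a constant configuration a = 1/4 or 3/4, the function (S - a)² plus a multiple of
the energy grows by O(γ/A²) per step, so the expectation of S stays within δ of a as long as k is at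
most a small multiple of (λ/γ)A². Since S is 1-Lipschitz for the sup norm and the two expectations
are at least 1/2 - 2δ apart, one of the two laws is at distance at least 1/4 - δ from equilibrium
(`le_worstDist`).

Upper bound: the quantile coupling preserves the coordinatewise order, so the chains started from
the all-0 and all-1 configurations sandwich all others (`wassersteinInf_gibbsLaw_le`). Small
expected energy makes both nearly constant, and their distance is then about the difference of the
two values of S. The expectation of this difference is nonincreasing in time, because the truncation
drift decreases with the configuration. While S < 1 - ε for the lower chain, its fluctuations raise
S² on average by order 1/(dA²) per step, and S² ≤ 1; hence the summed gap is at most kε + O(dA²)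
(`sum_topGap_le`), and by monotonicity the gap is at most 2ε once k is a large multiple of dA². -/

namespace GibbsNetwork

/-! ### Gaussians conditioned on the unit interval -/

/-- The Gaussian law with mean `m` and variance `1 / (2 s)`, conditioned on `[0,1]`. -/
noncomputable def truncGauss (s m : ℝ) : Measure I :=
  (volume : Measure I).tilted (fun x => -s * ((x : ℝ) - m) ^ 2)

lemma integrable_of_continuous {X : Type*} [TopologicalSpace X] [CompactSpace X]
    [MeasurableSpace X] [OpensMeasurableSpace X] {μ : Measure X} [IsFiniteMeasureOnCompacts μ]
    {f : X → ℝ} (hf : Continuous f) : Integrable f μ :=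
  hf.integrable_of_hasCompactSupport (HasCompactSupport.of_compactSpace _)

instance isProbabilityMeasure_truncGauss (s m : ℝ) : IsProbabilityMeasure (truncGauss s m) :=
  isProbabilityMeasure_tilted (integrable_of_continuous (by fun_prop))

lemma tilted_add_const {X : Type*} [MeasurableSpace X] (μ : Measure X) (f : X → ℝ) (c : ℝ) :
    μ.tilted (fun x => f x + c) = μ.tilted f := by
  simp only [Measure.tilted, Real.exp_add, integral_mul_const,
    mul_div_mul_right _ _ (Real.exp_pos c).ne']

lemma integral_unitInterval (f : ℝ → ℝ) : ∫ x : I, f x = ∫ x in (0 : ℝ)..1, f x := by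
  rw [intervalIntegral.integral_of_le zero_le_one, ← integral_Icc_eq_integral_Ioc]
  exact integral_subtype measurableSet_Icc f

lemma integral_truncGauss (s m : ℝ) (g : ℝ → ℝ) :
    ∫ x : I, g (x - m) ∂truncGauss s m =
      (∫ y in (-m)..(1 - m), g y * Real.exp (-s * y ^ 2)) /
        ∫ y in (-m)..(1 - m), Real.exp (-s * y ^ 2) := by
  have h1 := integral_unitInterval (fun x => Real.exp (-s * (x - m) ^ 2))
  have h2 := integral_unitInterval (fun x => g (x - m) * Real.exp (-s * (x - m) ^ 2))
  rw [intervalIntegral.integral_comp_sub_right (fun y => Real.exp (-s * y ^ 2)), zero_sub] at h1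
  rw [intervalIntegral.integral_comp_sub_right (fun y => g y * Real.exp (-s * y ^ 2)),
    zero_sub] at h2
  rw [truncGauss, integral_tilted, h1, ← h2, ← integral_div]
  refine integral_congr_ae (Filter.Eventually.of_forall fun x => ?_)
  simp only [smul_eq_mul]
  ring

section Gauss

variable {s : ℝ}

lemma intervalIntegrable_gauss (s a b : ℝ) :
    IntervalIntegrable (fun y => Real.exp (-s * y ^ 2)) volume a b :=
  Continuous.intervalIntegrable (by fun_prop) _ _

lemma intervalIntegrable_mul_gauss (s a b : ℝ) :
    IntervalIntegrable (fun y => y * Real.exp (-s * y ^ 2)) volume a b :=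
  Continuous.intervalIntegrable (by fun_prop) _ _

lemma gauss_pos {a b : ℝ} (s : ℝ) (hab : a < b) : 0 < ∫ y in a..b, Real.exp (-s * y ^ 2) :=
  intervalIntegral.intervalIntegral_pos_of_pos (intervalIntegrable_gauss s a b)
    (fun _ => Real.exp_pos _) hab

lemma gauss_nonneg {a b : ℝ} (s : ℝ) (hab : a ≤ b) : 0 ≤ ∫ y in a..b, Real.exp (-s * y ^ 2) :=
  intervalIntegral.integral_nonneg hab fun _ _ => (Real.exp_pos _).le

lemma integral_mul_gauss (hs : 0 < s) (a b : ℝ) :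
    ∫ y in a..b, y * Real.exp (-s * y ^ 2) =
      (Real.exp (-s * a ^ 2) - Real.exp (-s * b ^ 2)) / (2 * s) := by
  have hd : ∀ x ∈ Set.uIcc a b, HasDerivAt (fun y => -Real.exp (-s * y ^ 2) / (2 * s))
      (x * Real.exp (-s * x ^ 2)) x := by
    intro x _
    have h := ((((hasDerivAt_id x).pow 2).const_mul (-s)).exp.neg.div_const (2 * s))
    refine h.congr_deriv ?_
    simp only [id_eq, Nat.cast_ofNat, Nat.add_one_sub_one, pow_one, mul_one, Pi.pow_apply]
    field_simp
  rw [intervalIntegral.integral_eq_sub_of_hasDerivAt hd (intervalIntegrable_mul_gauss s a b)]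
  ring

lemma integral_sq_mul_gauss (hs : 0 < s) (a b : ℝ) :
    ∫ y in a..b, y ^ 2 * Real.exp (-s * y ^ 2) =
      (a * Real.exp (-s * a ^ 2) - b * Real.exp (-s * b ^ 2)) / (2 * s) +
        (∫ y in a..b, Real.exp (-s * y ^ 2)) / (2 * s) := by
  have hd : ∀ x ∈ Set.uIcc a b, HasDerivAt (fun y => -(y * Real.exp (-s * y ^ 2)) / (2 * s))
      (x ^ 2 * Real.exp (-s * x ^ 2) - Real.exp (-s * x ^ 2) / (2 * s)) x := by
    intro x _
    have h := (((hasDerivAt_id x).mul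
      (((hasDerivAt_id x).pow 2).const_mul (-s)).exp).neg.div_const (2 * s))
    refine h.congr_deriv ?_
    simp only [id_eq, Nat.cast_ofNat, Nat.add_one_sub_one, pow_one, mul_one, one_mul, Pi.pow_apply]
    field_simp
    ring
  have hi2 : IntervalIntegrable (fun y => y ^ 2 * Real.exp (-s * y ^ 2)) volume a b :=
    Continuous.intervalIntegrable (by fun_prop) _ _
  have hi0 : IntervalIntegrable (fun y => Real.exp (-s * y ^ 2) / (2 * s)) volume a b :=
    Continuous.intervalIntegrable (by fun_prop) _ _
  have h := intervalIntegral.integral_eq_sub_of_hasDerivAt hd (hi2.sub hi0)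
  rw [intervalIntegral.integral_sub hi2 hi0, intervalIntegral.integral_div] at h
  linear_combination h

/-- Extending the window to the right increases the conditional mean. -/
lemma gaussMean_mono_right {a b c : ℝ} (s : ℝ) (hab : a < b) (hbc : b ≤ c) :
    (∫ y in a..b, y * Real.exp (-s * y ^ 2)) / (∫ y in a..b, Real.exp (-s * y ^ 2)) ≤
      (∫ y in a..c, y * Real.exp (-s * y ^ 2)) / ∫ y in a..c, Real.exp (-s * y ^ 2) := by
  rw [div_le_div_iff₀ (gauss_pos s hab) (gauss_pos s (hab.trans_le hbc)),
    ← intervalIntegral.integral_add_adjacent_intervals (intervalIntegrable_mul_gauss s a b)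
      (intervalIntegrable_mul_gauss s b c),
    ← intervalIntegral.integral_add_adjacent_intervals (intervalIntegrable_gauss s a b)
      (intervalIntegrable_gauss s b c)]
  have h1 : ∫ y in a..b, y * Real.exp (-s * y ^ 2) ≤ b * ∫ y in a..b, Real.exp (-s * y ^ 2) := by
    rw [← intervalIntegral.integral_const_mul]
    exact intervalIntegral.integral_mono_on hab.le (intervalIntegrable_mul_gauss s a b)
      ((intervalIntegrable_gauss s a b).const_mul b)
      fun x hx => mul_le_mul_of_nonneg_right hx.2 (Real.exp_pos _).le
  have h2 : b * ∫ y in b..c, Real.exp (-s * y ^ 2) ≤ ∫ y in b..c, y * Real.exp (-s * y ^ 2) := by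
    rw [← intervalIntegral.integral_const_mul]
    exact intervalIntegral.integral_mono_on hbc ((intervalIntegrable_gauss s b c).const_mul b)
      (intervalIntegrable_mul_gauss s b c)
      fun x hx => mul_le_mul_of_nonneg_right hx.1 (Real.exp_pos _).le
  have h3 := mul_le_mul_of_nonneg_right h1 (gauss_nonneg s hbc)
  have h4 := mul_le_mul_of_nonneg_right h2 (gauss_nonneg s hab.le)
  nlinarith

lemma gaussMean_mono_left {a b c : ℝ} (s : ℝ) (hab : a ≤ b) (hbc : b < c) :
    (∫ y in a..c, y * Real.exp (-s * y ^ 2)) / (∫ y in a..c, Real.exp (-s * y ^ 2)) ≤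
      (∫ y in b..c, y * Real.exp (-s * y ^ 2)) / ∫ y in b..c, Real.exp (-s * y ^ 2) := by
  rw [div_le_div_iff₀ (gauss_pos s (hab.trans_lt hbc)) (gauss_pos s hbc),
    ← intervalIntegral.integral_add_adjacent_intervals (intervalIntegrable_mul_gauss s a b)
      (intervalIntegrable_mul_gauss s b c),
    ← intervalIntegral.integral_add_adjacent_intervals (intervalIntegrable_gauss s a b)
      (intervalIntegrable_gauss s b c)]
  have h1 : ∫ y in a..b, y * Real.exp (-s * y ^ 2) ≤ b * ∫ y in a..b, Real.exp (-s * y ^ 2) := by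
    rw [← intervalIntegral.integral_const_mul]
    exact intervalIntegral.integral_mono_on hab (intervalIntegrable_mul_gauss s a b)
      ((intervalIntegrable_gauss s a b).const_mul b)
      fun x hx => mul_le_mul_of_nonneg_right hx.2 (Real.exp_pos _).le
  have h2 : b * ∫ y in b..c, Real.exp (-s * y ^ 2) ≤ ∫ y in b..c, y * Real.exp (-s * y ^ 2) := by
    rw [← intervalIntegral.integral_const_mul]
    exact intervalIntegral.integral_mono_on hbc.le ((intervalIntegrable_gauss s b c).const_mul b)
      (intervalIntegrable_mul_gauss s b c)
      fun x hx => mul_le_mul_of_nonneg_right hx.1 (Real.exp_pos _).le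
  have h3 := mul_le_mul_of_nonneg_right h1 (gauss_nonneg s hbc.le)
  have h4 := mul_le_mul_of_nonneg_right h2 (gauss_nonneg s hab)
  nlinarith

end Gauss

section TruncGauss

variable {s : ℝ}

/-- The displacement of the mean of the truncated Gaussian from the mean of the Gaussian. -/
noncomputable def truncDrift (s m : ℝ) : ℝ := ∫ x : I, ((x : ℝ) - m) ∂truncGauss s m

lemma truncDrift_eq_div (s m : ℝ) :
    truncDrift s m = (∫ y in (-m)..(1 - m), y * Real.exp (-s * y ^ 2)) /
        ∫ y in (-m)..(1 - m), Real.exp (-s * y ^ 2) :=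
  integral_truncGauss s m fun y => y

lemma integral_truncGauss_id (s m : ℝ) : ∫ x : I, (x : ℝ) ∂truncGauss s m = m + truncDrift s m := by
  rw [truncDrift, integral_sub (integrable_of_continuous (by fun_prop)) (integrable_const _)]
  simp

/-- The truncated mean contracts distances. -/
lemma truncDrift_antitone (s : ℝ) : Antitone (truncDrift s) := by
  intro m m' h
  rw [truncDrift_eq_div, truncDrift_eq_div]
  -- After centring, the window is [a, a + 1]. Sliding it to the right means extending it on the
  -- right and then cutting it on the left; both raise the conditional mean.
  have key : Monotone fun a : ℝ =>
      (∫ y in a..(a + 1), y * Real.exp (-s * y ^ 2)) / ∫ y in a..(a + 1), Real.exp (-s * y ^ 2) :=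
    fun a b hab => (gaussMean_mono_right s (by linarith) (by linarith)).trans
      (gaussMean_mono_left s hab (by linarith))
  have := key (neg_le_neg h)
  simpa only [neg_add_eq_sub] using this

lemma truncDrift_eq (hs : 0 < s) (m : ℝ) :
    truncDrift s m = (Real.exp (-s * m ^ 2) - Real.exp (-s * (1 - m) ^ 2)) / (2 * s) /
        ∫ y in (-m)..(1 - m), Real.exp (-s * y ^ 2) := by
  rw [truncDrift_eq_div, integral_mul_gauss hs, neg_sq]

lemma truncDrift_nonneg (hs : 0 < s) {m : ℝ} (hm : m ≤ 1 / 2) : 0 ≤ truncDrift s m := by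
  rw [truncDrift_eq hs]
  refine div_nonneg (div_nonneg (sub_nonneg.2 (Real.exp_le_exp.2 ?_)) (by positivity))
    (gauss_nonneg s (by linarith))
  nlinarith

lemma truncDrift_nonpos (hs : 0 < s) {m : ℝ} (hm : 1 / 2 ≤ m) : truncDrift s m ≤ 0 := by
  rw [truncDrift_eq hs]
  refine div_nonpos_of_nonpos_of_nonneg (div_nonpos_of_nonpos_of_nonneg
    (sub_nonpos.2 (Real.exp_le_exp.2 ?_)) (by positivity)) (gauss_nonneg s (by linarith))
  nlinarith

/-- In `truncDrift_eq` the numerator is at most exp(-s r²), while the normalisation is at least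
(r/2) exp(-s r²/4). The ratio is exponentially small in s r²; only a polynomial bound is kept, since
it is all that the estimates need. -/
lemma abs_truncDrift_le_of_mem (hs : 0 < s) {m r : ℝ} (hr : 0 < r) (h1 : r ≤ m) (h2 : m ≤ 1 - r) :
    |truncDrift s m| ≤ 2 / (s ^ 2 * r ^ 3) := by
  have hZ : r / 2 * Real.exp (-s * (r / 2) ^ 2) ≤ ∫ y in (-m)..(1 - m), Real.exp (-s * y ^ 2) := by
    have e1 : ∫ y in (0 : ℝ)..(r / 2), Real.exp (-s * (r / 2) ^ 2) ≤
        ∫ y in (0 : ℝ)..(r / 2), Real.exp (-s * y ^ 2) := by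
      refine intervalIntegral.integral_mono_on (by positivity) (by simp)
        (intervalIntegrable_gauss _ _ _) fun x hx => Real.exp_le_exp.2 ?_
      have := pow_le_pow_left₀ hx.1 hx.2 2
      nlinarith
    rw [intervalIntegral.integral_const, smul_eq_mul, sub_zero] at e1
    refine e1.trans (intervalIntegral.integral_mono_interval (by linarith) (by linarith)
      (by linarith) (Filter.Eventually.of_forall fun x => (Real.exp_pos _).le)
      (intervalIntegrable_gauss _ _ _))
  have hnum : |Real.exp (-s * m ^ 2) - Real.exp (-s * (1 - m) ^ 2)| ≤ Real.exp (-s * r ^ 2) := by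
    have i1 : Real.exp (-s * m ^ 2) ≤ Real.exp (-s * r ^ 2) := by
      refine Real.exp_le_exp.2 ?_
      have := pow_le_pow_left₀ hr.le h1 2
      nlinarith
    have i2 : Real.exp (-s * (1 - m) ^ 2) ≤ Real.exp (-s * r ^ 2) := by
      refine Real.exp_le_exp.2 ?_
      have := pow_le_pow_left₀ hr.le (by linarith : r ≤ 1 - m) 2
      nlinarith
    rw [abs_le]
    constructor <;> linarith [Real.exp_pos (-s * m ^ 2), Real.exp_pos (-s * (1 - m) ^ 2)]
  rw [truncDrift_eq hs, div_div, abs_div, div_le_div_iff₀ _ (by positivity)]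
  swap
  · exact abs_pos.2 (mul_pos (by positivity) (gauss_pos s (by linarith))).ne'
  rw [abs_of_pos (mul_pos (by positivity : 0 < 2 * s) (gauss_pos s (by linarith)))]
  have hexp : Real.exp (-s * r ^ 2) * (s * r ^ 2) ≤ 2 * Real.exp (-s * (r / 2) ^ 2) := by
    have : Real.exp (-s * (r / 2) ^ 2) = Real.exp (-s * r ^ 2) * Real.exp (3 / 4 * (s * r ^ 2)) := by
      rw [← Real.exp_add]; congr 1; ring
    rw [this]
    have h := Real.add_one_le_exp (3 / 4 * (s * r ^ 2))
    have h0 : 0 < s * r ^ 2 := by positivity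
    nlinarith [Real.exp_pos (-s * r ^ 2)]
  calc _ ≤ Real.exp (-s * r ^ 2) * (s ^ 2 * r ^ 3) :=
        mul_le_mul_of_nonneg_right hnum (by positivity)
    _ = (Real.exp (-s * r ^ 2) * (s * r ^ 2)) * (s * r) := by ring
    _ ≤ (2 * Real.exp (-s * (r / 2) ^ 2)) * (s * r) :=
        mul_le_mul_of_nonneg_right hexp (by positivity)
    _ = 2 * (2 * s * (r / 2 * Real.exp (-s * (r / 2) ^ 2))) := by ring
    _ ≤ _ := by gcongr

/-- Integration by parts gives the untruncated variance plus boundary terms, which are nonpositive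
because the centre lies inside the interval. -/
lemma integral_sq_truncGauss_le (hs : 0 < s) {m : ℝ} (h0 : 0 ≤ m) (h1 : m ≤ 1) :
    ∫ x : I, ((x : ℝ) - m) ^ 2 ∂truncGauss s m ≤ 1 / (2 * s) := by
  rw [integral_truncGauss s m fun y => y ^ 2, integral_sq_mul_gauss hs, div_le_iff₀
    (gauss_pos s (by linarith))]
  have : (-m * Real.exp (-s * (-m) ^ 2) - (1 - m) * Real.exp (-s * (1 - m) ^ 2)) / (2 * s) ≤ 0 := by
    refine div_nonpos_of_nonpos_of_nonneg ?_ (by positivity)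
    nlinarith [mul_nonneg h0 (Real.exp_pos (-s * (-m) ^ 2)).le,
      mul_nonneg (sub_nonneg.2 h1) (Real.exp_pos (-s * (1 - m) ^ 2)).le]
  have e : 1 / (2 * s) * ∫ y in (-m)..(1 - m), Real.exp (-s * y ^ 2) =
    (∫ y in (-m)..(1 - m), Real.exp (-s * y ^ 2)) / (2 * s) := by ring
  linarith

lemma abs_truncDrift_le (hs : 0 < s) {m : ℝ} (h0 : 0 ≤ m) (h1 : m ≤ 1) :
    |truncDrift s m| ≤ 1 / √s := by
  have hs' : 0 < √s := Real.sqrt_pos.2 hs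
  calc |truncDrift s m| ≤ ∫ x : I, |(x : ℝ) - m| ∂truncGauss s m := abs_integral_le_integral_abs
    _ ≤ ∫ x : I, (1 / (2 * √s) + √s / 2 * ((x : ℝ) - m) ^ 2) ∂truncGauss s m := by
        refine integral_mono (integrable_of_continuous (by fun_prop))
          (integrable_of_continuous (by fun_prop)) fun x => ?_
        have : 0 ≤ (√s * |(x : ℝ) - m| - 1) ^ 2 / (2 * √s) := by positivity
        have e : (√s * |(x : ℝ) - m| - 1) ^ 2 / (2 * √s) =
            1 / (2 * √s) + √s / 2 * |(x : ℝ) - m| ^ 2 - |(x : ℝ) - m| := by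
          field_simp; ring
        rw [sq_abs] at e
        simp only
        linarith
    _ = 1 / (2 * √s) + √s / 2 * ∫ x : I, ((x : ℝ) - m) ^ 2 ∂truncGauss s m := by
        rw [integral_add (integrable_const _) (integrable_of_continuous (by fun_prop)),
          integral_const_mul]
        simp
    _ ≤ 1 / (2 * √s) + √s / 2 * (1 / (2 * s)) := by
        gcongr
        exact integral_sq_truncGauss_le hs h0 h1
    _ ≤ 1 / √s := by
        have : √s / 2 * (1 / (2 * s)) = 1 / (4 * √s) := by
          nth_rw 2 [← Real.mul_self_sqrt hs.le]
          field_simp; norm_num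
        rw [this]
        have : 1 / √s = 1 / (2 * √s) + 2 * (1 / (4 * √s)) := by field_simp; norm_num
        rw [this]
        have : 0 < 1 / (4 * √s) := by positivity
        linarith

/-- The pull of the truncation on the mean, tested against a direction `y` which is harmless
unless `m` is near the boundary while the reference point `S` is far from `m`. -/
lemma truncDrift_mul_le (hs : 0 < s) {m r y S : ℝ} (h0 : 0 ≤ m) (h1 : m ≤ 1) (hr : 0 < r)
    (hr2 : r ≤ 1 / 2) (hy : |y| ≤ 1) (hlo : m < r → 0 < y → r ≤ S - m)
    (hhi : 1 - r < m → y < 0 → r ≤ m - S) :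
    truncDrift s m * y ≤ 2 / (s ^ 2 * r ^ 3) + (S - m) ^ 2 / (√s * r ^ 2) := by
  have hs' : 0 < √s := Real.sqrt_pos.2 hs
  have p1 : 0 ≤ 2 / (s ^ 2 * r ^ 3) := by positivity
  have p2 : 0 ≤ (S - m) ^ 2 / (√s * r ^ 2) := by positivity
  have habs : truncDrift s m * y ≤ |truncDrift s m| := by
    calc _ ≤ |truncDrift s m * y| := le_abs_self _
      _ = |truncDrift s m| * |y| := abs_mul _ _
      _ ≤ |truncDrift s m| * 1 := by gcongr
      _ = _ := mul_one _
  have hfar : r ≤ |S - m| → truncDrift s m * y ≤ (S - m) ^ 2 / (√s * r ^ 2) := by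
    intro h
    refine habs.trans ((abs_truncDrift_le hs h0 h1).trans ?_)
    rw [div_le_div_iff₀ hs' (by positivity), ← sq_abs (S - m)]
    have := mul_le_mul_of_nonneg_right (pow_le_pow_left₀ hr.le h 2) hs'.le
    linarith
  -- Near a face the truncation pushes inward, so only a `y` pointing inward can hurt. Then |S - m|
  -- ≥ r, and the crude bound 1/√s may be multiplied by (S - m)²/r² ≥ 1. Away from the faces the
  -- interior bound applies.
  rcases lt_or_ge m r with hm | hm
  · rcases le_or_gt y 0 with hy0 | hy0
    · have := mul_nonpos_of_nonneg_of_nonpos (truncDrift_nonneg hs (by linarith : m ≤ 1 / 2)) hy0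
      linarith
    · have := hfar ((hlo hm hy0).trans (le_abs_self _))
      linarith
  rcases lt_or_ge (1 - r) m with hm' | hm'
  · rcases le_or_gt 0 y with hy0 | hy0
    · have := mul_nonpos_of_nonpos_of_nonneg (truncDrift_nonpos hs (by linarith : 1 / 2 ≤ m)) hy0
      linarith
    · have := hfar ((hhi hm' hy0).trans (by rw [abs_sub_comm]; exact le_abs_self _))
      linarith
  · have := abs_truncDrift_le_of_mem hs hr hm hm'
    linarith

/-- On the window the weight is at least exp(-1), and the second moment of an interval of length h
about any point is at least h³/12, its value about the midpoint. -/
lemma le_integral_sq_gauss_window (q : ℝ) {a b h : ℝ} (hh : 0 ≤ h) (hb : b = a + h)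
    (hw : ∀ y ∈ Set.Icc a b, s * y ^ 2 ≤ 1) :
    Real.exp (-1) * (h ^ 3 / 12) ≤ ∫ y in a..b, (y - q) ^ 2 * Real.exp (-s * y ^ 2) := by
  have e1 : ∫ y in a..b, (y - q) ^ 2 * Real.exp (-1) ≤
      ∫ y in a..b, (y - q) ^ 2 * Real.exp (-s * y ^ 2) := by
    refine intervalIntegral.integral_mono_on (by linarith)
      (Continuous.intervalIntegrable (by fun_prop) _ _)
      (Continuous.intervalIntegrable (by fun_prop) _ _) fun x hx => ?_
    refine mul_le_mul_of_nonneg_left (Real.exp_le_exp.2 ?_) (sq_nonneg _)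
    linarith [hw x hx]
  refine le_trans ?_ e1
  rw [intervalIntegral.integral_mul_const,
    intervalIntegral.integral_comp_sub_right (fun y => y ^ 2), integral_pow, mul_comm]
  refine mul_le_mul_of_nonneg_right ?_ (Real.exp_pos _).le
  subst hb
  norm_num
  nlinarith [mul_nonneg hh (sq_nonneg (a - q + h / 2))]

/-- The truncated Gaussian has at least the order of fluctuations of the Gaussian. -/
lemma le_integral_sq_truncGauss (hs : 4 ≤ s) {m : ℝ} (h0 : 0 ≤ m) (h1 : m ≤ 1) (p : ℝ) :
    1 / (100 * s) ≤ ∫ x : I, ((x : ℝ) - p) ^ 2 ∂truncGauss s m := by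
  have hs0 : 0 < s := by linarith
  have hs' : 0 < √s := Real.sqrt_pos.2 hs0
  have h2 : 2 ≤ √s := Real.le_sqrt_of_sq_le (by linarith)
  -- The scale of the Gaussian. As s ≥ 4, h ≤ 1/2, so a window of length h fits inside the interval
  -- on one side of `m`; the constant 1.78 below exceeds √π.
  set h : ℝ := 1 / √s with hdef
  have hh : 0 < h := by positivity
  have hle : h ≤ 1 / 2 := by rw [hdef]; gcongr
  have hsh : s * h ^ 2 = 1 := by
    rw [hdef, div_pow, Real.sq_sqrt hs0.le]; field_simp
  have key := integral_truncGauss s m fun y => (y - (p - m)) ^ 2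
  simp only [sub_sub_sub_cancel_right] at key
  rw [key, div_le_div_iff₀ (by positivity) (gauss_pos s (by linarith)), one_mul]
  have hZ : ∫ y in (-m)..(1 - m), Real.exp (-s * y ^ 2) ≤ 1.78 * h := by
    rw [intervalIntegral.integral_of_le (by linarith)]
    refine (setIntegral_le_integral (integrable_exp_neg_mul_sq hs0)
      (Filter.Eventually.of_forall fun x => (Real.exp_pos _).le)).trans ?_
    rw [integral_gaussian, Real.sqrt_div Real.pi_pos.le, div_eq_mul_one_div, ← hdef]
    refine mul_le_mul_of_nonneg_right (Real.sqrt_le_iff.2 ⟨by norm_num, ?_⟩) hh.le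
    have := Real.pi_lt_d2
    norm_num at this ⊢
    linarith
  have hN : Real.exp (-1) * (h ^ 3 / 12) ≤
      ∫ y in (-m)..(1 - m), (y - (p - m)) ^ 2 * Real.exp (-s * y ^ 2) := by
    have hsub : ∀ a b : ℝ, -m ≤ a → a ≤ b → b ≤ 1 - m →
        ∫ y in a..b, (y - (p - m)) ^ 2 * Real.exp (-s * y ^ 2) ≤
          ∫ y in (-m)..(1 - m), (y - (p - m)) ^ 2 * Real.exp (-s * y ^ 2) := fun a b i1 i2 i3 =>
      intervalIntegral.integral_mono_interval i1 i2 i3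
        (Filter.Eventually.of_forall fun x => mul_nonneg (sq_nonneg _) (Real.exp_pos _).le)
        (Continuous.intervalIntegrable (by fun_prop) _ _)
    have hsq : ∀ y : ℝ, |y| ≤ h → s * y ^ 2 ≤ 1 := by
      intro y hy
      rw [← hsh, ← sq_abs]
      have := pow_le_pow_left₀ (abs_nonneg y) hy 2
      gcongr
    rcases le_total m (1 / 2) with hm | hm
    · refine (le_integral_sq_gauss_window (p - m) hh.le (zero_add h).symm ?_).trans
        (hsub 0 h (by linarith) hh.le (by linarith))
      intro y hy
      exact hsq y (abs_le.2 ⟨by linarith [hy.1], hy.2⟩)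
    · refine (le_integral_sq_gauss_window (p - m) hh.le (neg_add_cancel h).symm ?_).trans
        (hsub (-h) 0 (by linarith) (by linarith) (by linarith))
      intro y hy
      exact hsq y (abs_le.2 ⟨hy.1, by linarith [hy.2]⟩)
  have hexp := Real.exp_neg_one_gt_d9
  have : 1.78 * h ≤ Real.exp (-1) * (h ^ 3 / 12) * (100 * s) := by
    have : Real.exp (-1) * (h ^ 3 / 12) * (100 * s) = Real.exp (-1) * (100 / 12) * h * (s * h ^ 2) := by
      ring
    rw [this, hsh]
    nlinarith
  refine hZ.trans (this.trans ?_)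
  gcongr

/-- The truncated Gaussians are stochastically increasing in `m`. -/
lemma truncGauss_Iic_antitone (hs : 0 ≤ s) (y : I) :
    Antitone fun m => (truncGauss s m).real (Set.Iic y) := by
  intro m m' h
  set θ : ℝ := 2 * s * (m' - m) with hθ
  have hθ0 : 0 ≤ θ := mul_nonneg (by positivity) (by linarith)
  -- Raising the centre amounts to an exponential tilt with nonnegative slope, up to a constant
  -- factor.
  have htilt : truncGauss s m' = (truncGauss s m).tilted fun x : I => θ * x := by
    rw [truncGauss, truncGauss, tilted_tilted (integrable_of_continuous (by fun_prop))]
    have : (fun x : I => -s * ((x : ℝ) - m') ^ 2) =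
        fun x => ((fun x : I => -s * ((x : ℝ) - m) ^ 2) + fun x : I => θ * x) x +
          (s * m ^ 2 - s * m' ^ 2) := by
      funext x
      simp only [Pi.add_apply, hθ]
      ring
    rw [this]
    exact tilted_add_const _ _ _
  set μ := truncGauss s m
  have hi : Integrable (fun x : I => Real.exp (θ * x)) μ := integrable_of_continuous (by fun_prop)
  set a := ∫ x in Set.Iic y, Real.exp (θ * x) ∂μ
  set b := ∫ x in (Set.Iic y)ᶜ, Real.exp (θ * x) ∂μ
  have hab : a + b = ∫ x : I, Real.exp (θ * x) ∂μ := integral_add_compl measurableSet_Iic hi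
  have hpos : 0 < a + b := by rw [hab]; exact integral_exp_pos hi
  have ha : a ≤ Real.exp (θ * y) * μ.real (Set.Iic y) := by
    refine (setIntegral_mono_on (g := fun _ => Real.exp (θ * y)) hi.integrableOn
      (integrable_const _).integrableOn measurableSet_Iic fun x hx => Real.exp_le_exp.2
        (mul_le_mul_of_nonneg_left hx hθ0)).trans_eq ?_
    rw [setIntegral_const, smul_eq_mul, mul_comm]
  have hb : Real.exp (θ * y) * μ.real (Set.Iic y)ᶜ ≤ b := by
    refine Eq.trans_le ?_ (setIntegral_mono_on (f := fun _ => Real.exp (θ * y))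
      (integrable_const _).integrableOn hi.integrableOn measurableSet_Iic.compl
      fun x hx => Real.exp_le_exp.2 (mul_le_mul_of_nonneg_left (le_of_lt (not_le.1 hx)) hθ0))
    rw [setIntegral_const, smul_eq_mul, mul_comm]
  rw [probReal_compl_eq_one_sub measurableSet_Iic] at hb
  have hval : (truncGauss s m').real (Set.Iic y) = a / (a + b) := by
    rw [htilt, measureReal_def, tilted_apply_eq_ofReal_integral, ENNReal.toReal_ofReal
      (integral_nonneg fun x => div_nonneg (Real.exp_pos _).le
        (integral_nonneg fun x => (Real.exp_pos _).le)), integral_div, hab]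
  simp only
  rw [hval, div_le_iff₀ hpos]
  have hP0 : 0 ≤ μ.real (Set.Iic y) := measureReal_nonneg
  have hP1 : μ.real (Set.Iic y) ≤ 1 := measureReal_le_one
  -- With P the old mass of the lower set, both a(1 - P) and bP are compared with exp(θy) P(1 - P);
  -- hence a ≤ P(a + b).
  nlinarith [mul_le_mul_of_nonneg_left hb hP0, mul_le_mul_of_nonneg_left ha (sub_nonneg.2 hP1)]

end TruncGauss

/-! ### The Dirichlet form and neighbour averages -/

namespace Network

variable {d : ℕ} (C : Network d)

/-- The weighted average of `f` over the neighbours of `i`. -/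
noncomputable def nbrMean (f : Fin d → ℝ) (i : Fin d) : ℝ :=
  (∑ j, C.weight i j * f j) / C.vertexWeight i

/-- The average of `f` with respect to the vertex weights. -/
noncomputable def wmean (f : Fin d → ℝ) : ℝ := ∑ i, C.vertexWeight i * f i

/-- The Dirichlet form of the network. -/
noncomputable def dirichlet (f : Fin d → ℝ) : ℝ :=
  1 / 2 * ∑ i, ∑ j, C.weight i j * (f i - f j) ^ 2

/-- The squared norm of `Δ f` in the weighted inner product. -/
noncomputable def dissip (f : Fin d → ℝ) : ℝ :=
  ∑ i, C.vertexWeight i * (f i - C.nbrMean f i) ^ 2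

/-- The variance of `f` with respect to the vertex weights. -/
noncomputable def wvar (f : Fin d → ℝ) : ℝ :=
  ∑ i, C.vertexWeight i * (f i - C.wmean f) ^ 2

lemma energy_eq (p : Fin d → I) : C.energy p = C.dirichlet fun i => (p i : ℝ) := by
  have h := Finset.sum_sum_Ioi_add_eq_sum_sum_off_diag
    (fun i j => C.weight j i * ((p j : ℝ) - p i) ^ 2)
  have h2 : ∀ i : Fin d, ∑ j ∈ ({i} : Finset (Fin d))ᶜ, C.weight i j * ((p i : ℝ) - p j) ^ 2 =
      ∑ j, C.weight i j * ((p i : ℝ) - p j) ^ 2 := fun i =>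
    Finset.sum_subset (Finset.subset_univ _) fun j _ hj => by
      have : j = i := by simpa using hj
      simp [this]
  simp only [h2] at h
  have h3 : ∀ i j : Fin d, C.weight i j * ((p i : ℝ) - p j) ^ 2 +
      C.weight j i * ((p j : ℝ) - p i) ^ 2 = 2 * (C.weight i j * ((p i : ℝ) - p j) ^ 2) :=
    fun i j => by rw [C.symm j i]; ring
  simp only [h3, ← Finset.mul_sum] at h
  rw [energy, dirichlet, ← h]
  ring

lemma dirichlet_nonneg (f : Fin d → ℝ) : 0 ≤ C.dirichlet f :=
  mul_nonneg (by norm_num) (Finset.sum_nonneg fun i _ => Finset.sum_nonneg fun j _ =>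
    mul_nonneg (C.nonneg i j) (sq_nonneg _))

lemma vertexWeight_nonneg (i : Fin d) : 0 ≤ C.vertexWeight i :=
  Finset.sum_nonneg fun j _ => C.nonneg i j

lemma sum_weight_mul_left (f : Fin d → ℝ) :
    ∑ i, ∑ j, C.weight i j * f j = ∑ j, C.vertexWeight j * f j := by
  rw [Finset.sum_comm]
  refine Finset.sum_congr rfl fun j _ => ?_
  rw [vertexWeight, Finset.sum_mul]
  exact Finset.sum_congr rfl fun i _ => by rw [C.symm]

lemma dirichlet_eq_sub (f : Fin d → ℝ) : C.dirichlet f =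
    ∑ i, C.vertexWeight i * f i ^ 2 - ∑ i, ∑ j, C.weight i j * (f i * f j) := by
  have h1 := C.sum_weight_mul_left fun j => f j ^ 2
  have h2 : ∑ i, ∑ j, C.weight i j * f i ^ 2 = ∑ i, C.vertexWeight i * f i ^ 2 :=
    Finset.sum_congr rfl fun i _ => by rw [vertexWeight, Finset.sum_mul]
  have h3 : ∑ i, ∑ j, C.weight i j * (f i - f j) ^ 2 = ∑ i, ∑ j, C.weight i j * f i ^ 2 +
      ∑ i, ∑ j, C.weight i j * f j ^ 2 - 2 * ∑ i, ∑ j, C.weight i j * (f i * f j) := by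
    simp only [Finset.mul_sum, ← Finset.sum_add_distrib, ← Finset.sum_sub_distrib]
    exact Finset.sum_congr rfl fun i _ => Finset.sum_congr rfl fun j _ => by ring
  rw [dirichlet, h3, h1, h2]
  ring

lemma weight_le_vertexWeight (i j : Fin d) : C.weight i j ≤ C.vertexWeight i :=
  Finset.single_le_sum (f := fun j => C.weight i j) (fun j _ => C.nonneg i j) (Finset.mem_univ j)

lemma vertexWeight_pos (hd : 2 ≤ d) (hC : C.IsConnected) (i : Fin d) : 0 < C.vertexWeight i := by
  have : Nontrivial (Fin d) := Fin.nontrivial_iff_two_le.2 hd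
  obtain ⟨j, hj⟩ := exists_ne i
  obtain ⟨w⟩ := hC.preconnected i j
  cases w with
  | nil => exact absurd rfl hj
  | cons h _ => exact lt_of_lt_of_le h (C.weight_le_vertexWeight _ _)

lemma eq_of_dirichlet_eq_zero (hC : C.IsConnected) {f : Fin d → ℝ} (hf : C.dirichlet f = 0)
    (i j : Fin d) : f i = f j := by
  have hadj : ∀ i j, 0 < C.weight i j → f i = f j := by
    intro i j hij
    have h0 : ∑ i, ∑ j, C.weight i j * (f i - f j) ^ 2 = 0 := by
      unfold dirichlet at hf; linarith
    have h1 := (Finset.sum_eq_zero_iff_of_nonneg fun i _ => Finset.sum_nonneg fun j _ =>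
      mul_nonneg (C.nonneg i j) (sq_nonneg (f i - f j))).1 h0 i (Finset.mem_univ i)
    have h2 := (Finset.sum_eq_zero_iff_of_nonneg fun j _ =>
      mul_nonneg (C.nonneg i j) (sq_nonneg (f i - f j))).1 h1 j (Finset.mem_univ j)
    have h3 := (mul_eq_zero.1 h2).resolve_left hij.ne'
    exact sub_eq_zero.1 (pow_eq_zero_iff two_ne_zero |>.1 h3)
  obtain ⟨w⟩ := hC.preconnected i j
  induction w with
  | nil => rfl
  | cons h _ ih => exact (hadj _ _ h).trans ih

lemma dirichlet_sub_const (f : Fin d → ℝ) (a : ℝ) :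
    C.dirichlet (fun i => f i - a) = C.dirichlet f := by
  simp [dirichlet]

section PositiveWeights

variable (hc : ∀ i, 0 < C.vertexWeight i)
include hc

lemma vertexWeight_mul_nbrMean (f : Fin d → ℝ) (i : Fin d) :
    C.vertexWeight i * C.nbrMean f i = ∑ j, C.weight i j * f j :=
  mul_div_cancel₀ _ (hc i).ne'

lemma dirichlet_eq_inner (f : Fin d → ℝ) :
    C.dirichlet f = ∑ i, C.vertexWeight i * (f i * (f i - C.nbrMean f i)) := by
  rw [dirichlet_eq_sub, ← Finset.sum_sub_distrib]
  refine Finset.sum_congr rfl fun i _ => ?_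
  have h := C.vertexWeight_mul_nbrMean hc f i
  have : ∑ j, C.weight i j * (f i * f j) = f i * ∑ j, C.weight i j * f j := by
    rw [Finset.mul_sum]; exact Finset.sum_congr rfl fun j _ => by ring
  rw [this, ← h]
  ring

lemma sum_vertexWeight_mul_nbrMean (f : Fin d → ℝ) :
    ∑ i, C.vertexWeight i * C.nbrMean f i = C.wmean f := by
  simp only [C.vertexWeight_mul_nbrMean hc]
  exact C.sum_weight_mul_left f

/-- As a function of one coordinate the energy is a parabola with minimum at the neighbour mean and
leading coefficient c_i; the absence of loops is what makes that coefficient exactly c_i. Both the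
conditional law and the energy drift come from this identity. -/
lemma dirichlet_update (f : Fin d → ℝ) (i : Fin d) (x : ℝ) :
    C.dirichlet (Function.update f i x) = C.dirichlet f +
      C.vertexWeight i * (x - C.nbrMean f i) ^ 2 -
        C.vertexWeight i * (f i - C.nbrMean f i) ^ 2 := by
  set e : Fin d → ℝ := fun k => if k = i then 1 else 0 with he
  have hu : Function.update f i x = fun k => f k + (x - f i) * e k := by
    funext k
    by_cases hk : k = i
    · subst hk; simp [he]
    · simp [he, hk]
  have h1 : ∑ k, C.vertexWeight k * (f k + (x - f i) * e k) ^ 2 =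
      ∑ k, C.vertexWeight k * f k ^ 2 + 2 * (x - f i) * ∑ k, e k * (C.vertexWeight k * f k) +
        (x - f i) ^ 2 * ∑ k, e k * (C.vertexWeight k * e k) := by
    simp only [Finset.mul_sum, ← Finset.sum_add_distrib]
    exact Finset.sum_congr rfl fun k _ => by ring
  have h2 : ∑ k, ∑ l, C.weight k l * ((f k + (x - f i) * e k) * (f l + (x - f i) * e l)) =
      ∑ k, ∑ l, C.weight k l * (f k * f l) + (x - f i) * ∑ k, e k * ∑ l, C.weight k l * f l +
        (x - f i) * ∑ k, ∑ l, C.weight k l * (f k * e l) +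
          (x - f i) ^ 2 * ∑ k, e k * ∑ l, e l * C.weight k l := by
    simp only [Finset.mul_sum, ← Finset.sum_add_distrib]
    exact Finset.sum_congr rfl fun k _ => Finset.sum_congr rfl fun l _ => by ring
  have h3 : ∑ k, ∑ l, C.weight k l * (f k * e l) = ∑ k, e k * ∑ l, C.weight k l * f l := by
    rw [Finset.sum_comm]
    simp only [Finset.mul_sum]
    exact Finset.sum_congr rfl fun k _ => Finset.sum_congr rfl fun l _ => by rw [C.symm k l]; ring
  rw [hu, dirichlet_eq_sub, dirichlet_eq_sub, h1, h2, h3]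
  simp only [he, ite_mul, one_mul, zero_mul, Finset.sum_ite_eq', Finset.mem_univ, if_true,
    C.no_loops, ← C.vertexWeight_mul_nbrMean hc f i]
  ring

lemma nbrMean_mono {f g : Fin d → ℝ} (h : ∀ j, f j ≤ g j) (i : Fin d) :
    C.nbrMean f i ≤ C.nbrMean g i :=
  div_le_div_of_nonneg_right (Finset.sum_le_sum fun j _ =>
    mul_le_mul_of_nonneg_left (h j) (C.nonneg i j)) (hc i).le

lemma nbrMean_const (a : ℝ) (i : Fin d) : C.nbrMean (fun _ => a) i = a := by
  rw [nbrMean, ← Finset.sum_mul]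
  exact mul_div_cancel_left₀ _ (hc i).ne'

lemma nbrMean_mem (p : Fin d → I) (i : Fin d) :
    0 ≤ C.nbrMean (fun j => (p j : ℝ)) i ∧ C.nbrMean (fun j => (p j : ℝ)) i ≤ 1 := by
  constructor
  · rw [← C.nbrMean_const hc 0 i]; exact C.nbrMean_mono hc (fun j => (p j).2.1) i
  · rw [← C.nbrMean_const hc 1 i]; exact C.nbrMean_mono hc (fun j => (p j).2.2) i

/-- Averaging over neighbours does not increase the spread around any level. -/
lemma sum_sq_sub_nbrMean_le (f : Fin d → ℝ) (a : ℝ) :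
    ∑ i, C.vertexWeight i * (a - C.nbrMean f i) ^ 2 ≤ ∑ i, C.vertexWeight i * (f i - a) ^ 2 := by
  rw [← C.sum_weight_mul_left fun j => (f j - a) ^ 2]
  refine Finset.sum_le_sum fun i _ => ?_
  have h1 := C.vertexWeight_mul_nbrMean hc f i
  have h2 : ∑ j, C.weight i j * (f j - a) ^ 2 = ∑ j, C.weight i j * (f j - C.nbrMean f i) ^ 2 +
      2 * (C.nbrMean f i - a) * (∑ j, C.weight i j * f j - C.nbrMean f i * ∑ j, C.weight i j) +
        (a - C.nbrMean f i) ^ 2 * ∑ j, C.weight i j := by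
    simp only [Finset.mul_sum, ← Finset.sum_add_distrib, ← Finset.sum_sub_distrib]
    exact Finset.sum_congr rfl fun j _ => by ring
  have h3 : 0 ≤ ∑ j, C.weight i j * (f j - C.nbrMean f i) ^ 2 :=
    Finset.sum_nonneg fun j _ => mul_nonneg (C.nonneg i j) (sq_nonneg _)
  have h4 : ∑ j, C.weight i j = C.vertexWeight i := rfl
  rw [h2, ← h1, h4]
  linarith

section Unit

variable (hu : C.UnitTotalWeight)
include hu

omit hc in
lemma sum_vertexWeight : ∑ i, C.vertexWeight i = 1 := hu

omit hc in
lemma sum_vertexWeight_mul_sub_wmean (f : Fin d → ℝ) :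
    ∑ i, C.vertexWeight i * (f i - C.wmean f) = 0 := by
  simp only [mul_sub, Finset.sum_sub_distrib, ← Finset.sum_mul, C.sum_vertexWeight hu, one_mul]
  exact sub_self _

end Unit

end PositiveWeights

end Network

/-! ### Spectral decomposition and Poincaré inequalities -/

section Hermitian

variable {n : ℕ} {H : Matrix (Fin n) (Fin n) ℝ} (hH : H.IsHermitian)

/-- The coordinate of a vector along an eigenvector. -/
noncomputable def eigenCoord (g : Fin n → ℝ) (j : Fin n) : ℝ :=
  inner ℝ (hH.eigenvectorBasis j) (WithLp.toLp 2 g)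

lemma sum_sq_eq_sum_eigenCoord (g : Fin n → ℝ) : ∑ i, g i ^ 2 = ∑ j, eigenCoord hH g j ^ 2 := by
  have h := hH.eigenvectorBasis.sum_sq_norm_inner_right (WithLp.toLp 2 g)
  simp only [Real.norm_eq_abs, sq_abs, EuclideanSpace.norm_sq_eq] at h
  exact h.symm

lemma eigenCoord_mulVec (g : Fin n → ℝ) (j : Fin n) :
    eigenCoord hH (H.mulVec g) j = hH.eigenvalues j * eigenCoord hH g j := by
  have h := hH.mulVec_eigenvectorBasis j
  have hs : H.transpose = H := by simpa using hH.eq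
  have e : ∀ x : EuclideanSpace ℝ (Fin n), ∀ y : Fin n → ℝ,
      inner ℝ x (WithLp.toLp 2 y) = y ⬝ᵥ x.ofLp := by
    intro x y
    simp [EuclideanSpace.inner_eq_star_dotProduct]
  simp only [eigenCoord, e]
  rw [dotProduct_comm, Matrix.dotProduct_mulVec, ← Matrix.mulVec_transpose, hs, h, smul_dotProduct,
    dotProduct_comm, smul_eq_mul]

lemma dotProduct_mulVec_eq_sum_eigenCoord (g : Fin n → ℝ) :
    g ⬝ᵥ H.mulVec g = ∑ j, hH.eigenvalues j * eigenCoord hH g j ^ 2 := by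
  have h := hH.eigenvectorBasis.sum_inner_mul_inner (WithLp.toLp 2 g) (WithLp.toLp 2 (H.mulVec g))
  have e : (inner ℝ (WithLp.toLp 2 g) (WithLp.toLp 2 (H.mulVec g)) : ℝ) = g ⬝ᵥ H.mulVec g := by
    rw [EuclideanSpace.inner_eq_star_dotProduct, dotProduct_comm]
    simp
  rw [← e, ← h]
  refine Finset.sum_congr rfl fun j _ => ?_
  have h2 := eigenCoord_mulVec hH g j
  rw [eigenCoord] at h2
  rw [h2, real_inner_comm, eigenCoord]
  ring

end Hermitian

namespace Network

variable {d : ℕ} (C : Network d)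

/-- The symmetric matrix `D^{-1/2} (D - C) D^{-1/2}`, which is similar to the Laplacian. -/
noncomputable def symLaplacian : Matrix (Fin d) (Fin d) ℝ :=
  Matrix.diagonal (fun i => (√(C.vertexWeight i))⁻¹) *
    (Matrix.diagonal C.vertexWeight - C.weight) *
      Matrix.diagonal (fun i => (√(C.vertexWeight i))⁻¹)

lemma isHermitian_symLaplacian : C.symLaplacian.IsHermitian := by
  have h : C.weight.transpose = C.weight := Matrix.ext fun i j => C.symm j i
  rw [Matrix.IsHermitian, Matrix.conjTranspose_eq_transpose_of_trivial, symLaplacian]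
  simp [Matrix.transpose_mul, h, Matrix.mul_assoc]

/-- Moving the right factor D^{-1/2} to the front by the cyclic invariance of the characteristic
polynomial turns the product into D⁻¹(D - C) = I - D⁻¹C. -/
lemma charpoly_symLaplacian (hc : ∀ i, 0 < C.vertexWeight i) :
    C.symLaplacian.charpoly = C.laplacian.charpoly := by
  rw [symLaplacian, Matrix.charpoly_mul_comm, ← Matrix.mul_assoc, Matrix.diagonal_mul_diagonal,
    laplacian]
  have h : ∀ i, (√(C.vertexWeight i))⁻¹ * (√(C.vertexWeight i))⁻¹ = (C.vertexWeight i)⁻¹ :=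
    fun i => by rw [← mul_inv, Real.mul_self_sqrt (hc i).le]
  simp only [h, mul_sub, Matrix.diagonal_mul_diagonal, inv_mul_cancel₀ (hc _).ne',
    Matrix.diagonal_one]

lemma symLaplacian_mulVec (hc : ∀ i, 0 < C.vertexWeight i) (f : Fin d → ℝ) :
    C.symLaplacian.mulVec (fun i => √(C.vertexWeight i) * f i) =
      fun i => √(C.vertexWeight i) * (f i - C.nbrMean f i) := by
  funext i
  have hs : ∀ i, 0 < √(C.vertexWeight i) := fun i => Real.sqrt_pos.2 (hc i)
  have e1 : (Matrix.diagonal (fun i => (√(C.vertexWeight i))⁻¹)).mulVec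
      (fun i => √(C.vertexWeight i) * f i) = f := by
    funext j
    rw [Matrix.mulVec_diagonal, inv_mul_cancel_left₀ (hs j).ne']
  rw [symLaplacian, ← Matrix.mulVec_mulVec, e1, ← Matrix.mulVec_mulVec, Matrix.mulVec_diagonal,
    Matrix.sub_mulVec, Pi.sub_apply, Matrix.mulVec_diagonal]
  have e2 : C.weight.mulVec f i = C.vertexWeight i * C.nbrMean f i := by
    rw [C.vertexWeight_mul_nbrMean hc]; rfl
  rw [e2, ← mul_sub, ← mul_assoc]
  congr 1
  nth_rw 2 [← Real.mul_self_sqrt (hc i).le]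
  exact inv_mul_cancel_left₀ (hs i).ne' _

lemma dotProduct_symLaplacian (hc : ∀ i, 0 < C.vertexWeight i) (f : Fin d → ℝ) :
    (fun i => √(C.vertexWeight i) * f i) ⬝ᵥ
      C.symLaplacian.mulVec (fun i => √(C.vertexWeight i) * f i) = C.dirichlet f := by
  rw [C.symLaplacian_mulVec hc, C.dirichlet_eq_inner hc]
  refine Finset.sum_congr rfl fun i _ => ?_
  linear_combination (f i * (f i - C.nbrMean f i)) * Real.mul_self_sqrt (hc i).le

/-- A sorted list of nonnegative reals obtained from a multiset of the form `0 ::ₘ s`. -/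
lemma getD_sort_zero_cons {s : Multiset ℝ} {n : ℕ} (hs : s.card = n + 1) (h0 : ∀ x ∈ s, 0 ≤ x) :
    ((0 ::ₘ s).sort (· ≤ ·)).getD 1 0 ∈ s ∧
      ∀ x ∈ s, ((0 ::ₘ s).sort (· ≤ ·)).getD 1 0 ≤ x ∧
        x ≤ ((0 ::ₘ s).sort (· ≤ ·)).getD (n + 1) 0 := by
  rw [Multiset.sort_cons _ _ _ h0]
  have hlen : (s.sort (· ≤ ·)).length = n + 1 := by rw [Multiset.length_sort, hs]
  have hp : (s.sort (· ≤ ·)).Pairwise (· ≤ ·) := Multiset.pairwise_sort _ _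
  simp only [List.getD_cons_succ]
  rw [List.getD_eq_getElem _ _ (by omega : 0 < (s.sort (· ≤ ·)).length),
    List.getD_eq_getElem _ _ (by omega : n < (s.sort (· ≤ ·)).length)]
  refine ⟨(Multiset.mem_sort _).1 (List.getElem_mem _), fun x hx => ?_⟩
  obtain ⟨k, hk, rfl⟩ := List.getElem_of_mem ((Multiset.mem_sort (· ≤ ·)).2 hx)
  have hmono : ∀ a b (ha : a < (s.sort (· ≤ ·)).length) (hb : b < (s.sort (· ≤ ·)).length),
      a ≤ b → (s.sort (· ≤ ·))[a] ≤ (s.sort (· ≤ ·))[b] := by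
    intro a b ha hb hab
    rcases hab.lt_or_eq with h | h
    · exact List.pairwise_iff_getElem.1 hp a b ha hb h
    · subst h; exact le_rfl
  exact ⟨hmono _ _ _ _ (Nat.zero_le _), hmono _ _ _ _ (by omega)⟩

/-- Variational bounds for the extreme nonzero eigenvalues of the Laplacian. -/
theorem spectral_bounds (hd : 2 ≤ d) (hC : C.IsConnected) :
    0 < C.gap ∧ ∀ f : Fin d → ℝ, C.wmean f = 0 →
      C.gap * ∑ i, C.vertexWeight i * f i ^ 2 ≤ C.dirichlet f ∧
        C.dirichlet f ≤ C.top * ∑ i, C.vertexWeight i * f i ^ 2 := by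
  have hc := C.vertexWeight_pos hd hC
  have hs : ∀ i, 0 < √(C.vertexWeight i) := fun i => Real.sqrt_pos.2 (hc i)
  have hH := C.isHermitian_symLaplacian
  set μ := hH.eigenvalues with hμ
  set v : Fin d → Fin d → ℝ := fun j => (hH.eigenvectorBasis j).ofLp with hv
  -- Dividing an eigenvector by √c turns it into a function on the network, whose Dirichlet form is
  -- the eigenvalue.
  set w : Fin d → Fin d → ℝ := fun j i => v j i / √(C.vertexWeight i) with hw
  have hvw : ∀ j, v j = fun i => √(C.vertexWeight i) * w j i := fun j => by
    funext i; rw [hw]; exact (mul_div_cancel₀ _ (hs i).ne').symm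
  have hcoord : ∀ g j, eigenCoord hH g j = g ⬝ᵥ v j := by
    intro g j
    simp [eigenCoord, EuclideanSpace.inner_eq_star_dotProduct, hv]
  have horth : ∀ j k, v j ⬝ᵥ v k = if j = k then 1 else 0 := by
    intro j k
    have := orthonormal_iff_ite.1 hH.eigenvectorBasis.orthonormal k j
    rw [EuclideanSpace.inner_eq_star_dotProduct] at this
    simpa [eq_comm] using this
  have hμen : ∀ j, μ j = C.dirichlet (w j) := by
    intro j
    rw [← C.dotProduct_symLaplacian hc, ← hvw j, hv, hH.mulVec_eigenvectorBasis j, dotProduct_smul]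
    have := horth j j
    simp only [hv, if_true] at this
    rw [this, smul_eq_mul, mul_one]
  have hμ0 : ∀ j, 0 ≤ μ j := fun j => by rw [hμen]; exact C.dirichlet_nonneg _
  have hd0 : 0 < d := by omega
  -- An eigenvector for 0 has zero Dirichlet form, so connectedness makes it a multiple of √c.
  have hzero : ∀ j, μ j = 0 → ∃ κ : ℝ, κ ≠ 0 ∧ v j = fun i => √(C.vertexWeight i) * κ := by
    intro j hj
    rw [hμen] at hj
    have hconst := C.eq_of_dirichlet_eq_zero hC hj
    have hvj : v j = fun i => √(C.vertexWeight i) * w j ⟨0, hd0⟩ := by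
      rw [hvw j]; funext i; rw [hconst i ⟨0, hd0⟩]
    refine ⟨w j ⟨0, hd0⟩, fun h => ?_, hvj⟩
    have := horth j j
    rw [hvj, h] at this
    simp [dotProduct] at this
  have hone : C.symLaplacian.mulVec (fun i => √(C.vertexWeight i) * 1) = 0 := by
    rw [C.symLaplacian_mulVec hc fun _ => 1]
    funext i
    rw [C.nbrMean_const hc]; simp
  -- The vector √c is nonzero and lies in the kernel; if no eigenvalue vanished, all its
  -- eigencoordinates would.
  obtain ⟨j0, hj0⟩ : ∃ j, μ j = 0 := by
    by_contra hne
    push Not at hne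
    have h1 : ∀ j, eigenCoord hH (fun i => √(C.vertexWeight i) * 1) j = 0 := by
      intro j
      have h := eigenCoord_mulVec hH (fun i => √(C.vertexWeight i) * 1) j
      rw [hone, hcoord, zero_dotProduct] at h
      exact (mul_eq_zero.1 h.symm).resolve_left (hne j)
    have h2 := sum_sq_eq_sum_eigenCoord hH (fun i => √(C.vertexWeight i) * 1)
    simp only [h1] at h2
    have h3 : 0 < ∑ i, (√(C.vertexWeight i) * 1) ^ 2 :=
      Finset.sum_pos (fun i _ => by have := hs i; positivity) ⟨⟨0, hd0⟩, Finset.mem_univ _⟩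
    simp only [ne_eq, OfNat.ofNat_ne_zero, not_false_eq_true, zero_pow, Finset.sum_const_zero] at h2
    linarith
  obtain ⟨κ, hκ, hvκ⟩ := hzero j0 hj0
  -- The eigenvalue 0 is simple: two nonzero multiples of √c cannot be orthogonal.
  have hpos : ∀ j, j ≠ j0 → 0 < μ j := by
    intro j hj
    refine (hμ0 j).lt_of_ne fun h => ?_
    obtain ⟨κ', hκ', hvκ'⟩ := hzero j h.symm
    have := horth j j0
    rw [if_neg hj, hvκ, hvκ'] at this
    have hp : ∑ i, (√(C.vertexWeight i) * κ') * (√(C.vertexWeight i) * κ) =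
        κ' * κ * ∑ i, √(C.vertexWeight i) ^ 2 := by
      rw [Finset.mul_sum]; exact Finset.sum_congr rfl fun i _ => by ring
    rw [dotProduct, hp] at this
    have h3 : 0 < ∑ i, √(C.vertexWeight i) ^ 2 :=
      Finset.sum_pos (fun i _ => by have := hs i; positivity) ⟨⟨0, hd0⟩, Finset.mem_univ _⟩
    simp [hκ, hκ', h3.ne'] at this
  have hroots : C.laplacian.charpoly.roots =
      0 ::ₘ ((Finset.univ.erase j0).val.map μ) := by
    rw [← C.charpoly_symLaplacian hc, hH.roots_charpoly_eq_eigenvalues]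
    have : (Finset.univ : Finset (Fin d)).val = j0 ::ₘ (Finset.univ.erase j0).val := by
      rw [Finset.erase_val]
      exact (Multiset.cons_erase (Finset.mem_univ j0)).symm
    rw [this, Multiset.map_cons]
    simp [← hμ, hj0]
  obtain ⟨n, rfl⟩ : ∃ n, d = n + 2 := ⟨d - 2, by omega⟩
  have hcard : ((Finset.univ.erase j0).val.map μ).card = n + 1 := by
    rw [Multiset.card_map, Finset.card_val, Finset.card_erase_of_mem (Finset.mem_univ _)]
    simp
  obtain ⟨hmem, hall⟩ := getD_sort_zero_cons hcard fun x hx => by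
    obtain ⟨j, _, rfl⟩ := Multiset.mem_map.1 hx
    exact hμ0 j
  rw [← hroots] at hmem hall
  change C.gap ∈ _ at hmem
  have hall' : ∀ j, j ≠ j0 → C.gap ≤ μ j ∧ μ j ≤ C.top := fun j hj =>
    hall (μ j) (Multiset.mem_map_of_mem _ (Finset.mem_erase.2 ⟨hj, Finset.mem_univ _⟩))
  refine ⟨?_, fun f hf => ?_⟩
  · obtain ⟨j, hj, hjg⟩ := Multiset.mem_map.1 hmem
    rw [← hjg]
    exact hpos j (Finset.ne_of_mem_erase (s := Finset.univ) hj)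
  · have hcoord0 : eigenCoord hH (fun i => √(C.vertexWeight i) * f i) j0 = 0 := by
      rw [hcoord, hvκ]
      have : ∑ i, (√(C.vertexWeight i) * f i) * (√(C.vertexWeight i) * κ) =
          κ * ∑ i, C.vertexWeight i * f i := by
        rw [Finset.mul_sum]
        refine Finset.sum_congr rfl fun i _ => ?_
        nth_rw 3 [← Real.mul_self_sqrt (hc i).le]
        ring
      rw [dotProduct, this]
      change κ * C.wmean f = 0
      rw [hf, mul_zero]
    have hsq : ∑ i, C.vertexWeight i * f i ^ 2 =
        ∑ j, eigenCoord hH (fun i => √(C.vertexWeight i) * f i) j ^ 2 := by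
      rw [← sum_sq_eq_sum_eigenCoord]
      exact Finset.sum_congr rfl fun i _ => by rw [mul_pow, Real.sq_sqrt (hc i).le]
    rw [hsq, ← C.dotProduct_symLaplacian hc, dotProduct_mulVec_eq_sum_eigenCoord hH,
      Finset.mul_sum, Finset.mul_sum]
    constructor
    · refine Finset.sum_le_sum fun j _ => ?_
      by_cases hj : j = j0
      · subst hj; simp [hcoord0]
      · exact mul_le_mul_of_nonneg_right (hall' j hj).1 (sq_nonneg _)
    · refine Finset.sum_le_sum fun j _ => ?_
      by_cases hj : j = j0
      · subst hj; simp [hcoord0]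
      · exact mul_le_mul_of_nonneg_right (hall' j hj).2 (sq_nonneg _)

section Poincare

variable (hd : 2 ≤ d) (hC : C.IsConnected) (hu : C.UnitTotalWeight)
include hd hC

lemma gap_pos : 0 < C.gap := (C.spectral_bounds hd hC).1

omit hC in
lemma exists_beta_eq : ∃ i, C.beta = C.vertexWeight i := by
  have : Nonempty (Fin d) := ⟨⟨0, by omega⟩⟩
  obtain ⟨i, hi⟩ := exists_eq_ciInf_of_finite (f := C.vertexWeight)
  exact ⟨i, hi.symm⟩

lemma beta_pos : 0 < C.beta := by
  obtain ⟨i, hi⟩ := C.exists_beta_eq hd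
  rw [hi]; exact C.vertexWeight_pos hd hC i

omit hd hC in
lemma beta_le (i : Fin d) : C.beta ≤ C.vertexWeight i :=
  ciInf_le (Set.finite_range _).bddBelow i

include hu

omit hd hC in
lemma natCast_mul_beta_le : d * C.beta ≤ 1 := by
  rw [← C.sum_vertexWeight hu]
  simpa using Finset.card_nsmul_le_sum Finset.univ C.vertexWeight C.beta fun i _ => C.beta_le i

omit hd hC in
lemma wmean_sub_wmean (f : Fin d → ℝ) : C.wmean (fun i => f i - C.wmean f) = 0 :=
  C.sum_vertexWeight_mul_sub_wmean hu f

/-- The Poincaré inequality. -/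
lemma gap_mul_wvar_le (f : Fin d → ℝ) : C.gap * C.wvar f ≤ C.dirichlet f := by
  rw [← C.dirichlet_sub_const f (C.wmean f)]
  exact ((C.spectral_bounds hd hC).2 _ (C.wmean_sub_wmean hu f)).1

lemma dirichlet_le_top_mul_wvar (f : Fin d → ℝ) : C.dirichlet f ≤ C.top * C.wvar f := by
  rw [← C.dirichlet_sub_const f (C.wmean f)]
  exact ((C.spectral_bounds hd hC).2 _ (C.wmean_sub_wmean hu f)).2

omit hd hC hu in
lemma dissip_nonneg (f : Fin d → ℝ) : 0 ≤ C.dissip f :=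
  Finset.sum_nonneg fun i _ => mul_nonneg (C.vertexWeight_nonneg i) (sq_nonneg _)

omit hu in
-- Cauchy–Schwarz: the Dirichlet form is the weighted inner product of f - S(f) with Δf, since Δf
-- has weighted mean zero.
lemma sq_dirichlet_le (f : Fin d → ℝ) : C.dirichlet f ^ 2 ≤ C.wvar f * C.dissip f := by
  have hc := C.vertexWeight_pos hd hC
  have h0 : ∑ i, C.vertexWeight i * (f i - C.nbrMean f i) = 0 := by
    simp only [mul_sub, Finset.sum_sub_distrib, C.sum_vertexWeight_mul_nbrMean hc]
    exact sub_self _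
  have h1 : C.dirichlet f = ∑ i, (√(C.vertexWeight i) * (f i - C.wmean f)) *
      (√(C.vertexWeight i) * (f i - C.nbrMean f i)) := by
    have : ∑ i, (√(C.vertexWeight i) * (f i - C.wmean f)) *
        (√(C.vertexWeight i) * (f i - C.nbrMean f i)) =
          ∑ i, C.vertexWeight i * (f i * (f i - C.nbrMean f i)) -
            C.wmean f * ∑ i, C.vertexWeight i * (f i - C.nbrMean f i) := by
      rw [Finset.mul_sum, ← Finset.sum_sub_distrib]
      refine Finset.sum_congr rfl fun i _ => ?_
      linear_combination ((f i - C.wmean f) * (f i - C.nbrMean f i)) *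
        Real.mul_self_sqrt (hc i).le
    rw [this, h0, mul_zero, sub_zero, C.dirichlet_eq_inner hc]
  rw [h1]
  refine (Finset.sum_mul_sq_le_sq_mul_sq _ _ _).trans_eq ?_
  simp only [mul_pow, Real.sq_sqrt (hc _).le]
  rfl

/-- The Poincaré inequality inserted into Cauchy–Schwarz, then division by the Dirichlet form. This
turns dissipation into exponential decay of the energy. -/
lemma gap_mul_dirichlet_le (f : Fin d → ℝ) : C.gap * C.dirichlet f ≤ C.dissip f := by
  have h1 := C.sq_dirichlet_le hd hC f
  have h2 := C.gap_mul_wvar_le hd hC hu f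
  have hg := C.gap_pos hd hC
  have h3 := C.dissip_nonneg f
  rcases (C.dirichlet_nonneg f).eq_or_lt with h0 | h0
  · rw [← h0, mul_zero]; exact h3
  · refine le_of_mul_le_mul_right ?_ h0
    calc C.gap * C.dirichlet f * C.dirichlet f = C.gap * C.dirichlet f ^ 2 := by ring
      _ ≤ C.gap * (C.wvar f * C.dissip f) := mul_le_mul_of_nonneg_left h1 hg.le
      _ = C.gap * C.wvar f * C.dissip f := by ring
      _ ≤ C.dirichlet f * C.dissip f := mul_le_mul_of_nonneg_right h2 h3
      _ = _ := mul_comm _ _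

lemma sq_gap_mul_wvar_le (f : Fin d → ℝ) : C.gap ^ 2 * C.wvar f ≤ C.dissip f := by
  refine le_trans ?_ (C.gap_mul_dirichlet_le hd hC hu f)
  rw [pow_two, mul_assoc]
  exact mul_le_mul_of_nonneg_left (C.gap_mul_wvar_le hd hC hu f) (C.gap_pos hd hC).le

omit hd hC hu in
lemma wmean_single (i : Fin d) : C.wmean (Pi.single i 1) = C.vertexWeight i := by
  simp [wmean, Pi.single_apply]

omit hd hC in
lemma wvar_single (i : Fin d) :
    C.wvar (Pi.single i 1) = C.vertexWeight i * (1 - C.vertexWeight i) := by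
  have : ∀ f : Fin d → ℝ, C.wvar f = ∑ j, C.vertexWeight j * f j ^ 2 - C.wmean f ^ 2 := by
    intro f
    have : C.wvar f = ∑ j, C.vertexWeight j * f j ^ 2 - 2 * C.wmean f * C.wmean f +
        C.wmean f ^ 2 * ∑ j, C.vertexWeight j := by
      nth_rw 2 [wmean]
      simp only [wvar, Finset.mul_sum, ← Finset.sum_add_distrib, ← Finset.sum_sub_distrib]
      exact Finset.sum_congr rfl fun j _ => by ring
    rw [this, C.sum_vertexWeight hu]; ring
  rw [this, wmean_single]
  simp [Pi.single_apply]
  ring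

omit hu in
lemma dirichlet_single (i : Fin d) : C.dirichlet (Pi.single i 1) = C.vertexWeight i := by
  rw [C.dirichlet_eq_inner (C.vertexWeight_pos hd hC)]
  simp [Pi.single_apply, nbrMean, C.no_loops]

omit hd hC in
lemma vertexWeight_le_half (i : Fin d) : C.vertexWeight i ≤ 1 / 2 := by
  have h1 := C.sum_vertexWeight hu
  rw [← Finset.add_sum_erase _ _ (Finset.mem_univ i)] at h1
  have h2 : C.vertexWeight i ≤ ∑ j ∈ Finset.univ.erase i, C.vertexWeight j := by
    rw [vertexWeight, ← Finset.add_sum_erase _ _ (Finset.mem_univ i), C.no_loops, zero_add]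
    exact Finset.sum_le_sum fun j _ => by rw [C.symm]; exact C.weight_le_vertexWeight j i
  linarith

lemma gap_le_two : C.gap ≤ 2 := by
  have i : Fin d := ⟨0, by omega⟩
  have h := C.gap_mul_wvar_le hd hC hu (Pi.single i 1)
  have hc := C.vertexWeight_pos hd hC i
  have hg := C.gap_pos hd hC
  rw [C.wvar_single hu, C.dirichlet_single hd hC] at h
  have h2 := C.vertexWeight_le_half hu i
  have h3 : C.gap * (1 - C.vertexWeight i) ≤ 1 := by
    refine le_of_mul_le_mul_right ?_ hc
    linarith
  nlinarith

/-- Testing λ_d on the indicator of a vertex gives λ_d ≥ 1/(1 - c_i) ≥ 1 + c_i. Thus γ dominates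
every vertex weight, and hence also 1/d; this is how γ enters the lower bound. -/
lemma vertexWeight_le_gam (i : Fin d) : C.vertexWeight i ≤ C.gam := by
  have h := C.dirichlet_le_top_mul_wvar hd hC hu (Pi.single i 1)
  have hc := C.vertexWeight_pos hd hC i
  rw [C.wvar_single hu, C.dirichlet_single hd hC] at h
  have h2 := C.vertexWeight_le_half hu i
  have h3 : 1 ≤ C.top * (1 - C.vertexWeight i) := by
    refine le_of_mul_le_mul_right ?_ hc
    linarith
  have h4 : C.top - 1 ≤ C.gam := by
    refine le_trans ?_ (le_max_right _ _)
    rw [abs_sub_comm]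
    exact le_abs_self _
  nlinarith

lemma one_le_natCast_mul_gam : 1 ≤ d * C.gam := by
  rw [← C.sum_vertexWeight hu]
  simpa using Finset.sum_le_card_nsmul Finset.univ C.vertexWeight C.gam fun i _ =>
    C.vertexWeight_le_gam hd hC hu i

lemma beta_le_gam : C.beta ≤ C.gam := by
  obtain ⟨i, hi⟩ := C.exists_beta_eq hd
  rw [hi]; exact C.vertexWeight_le_gam hd hC hu i

end Poincare

end Network

/-! ### Quantile functions on the unit interval -/

section Quantile

/-- The quantile function of a probability measure on `[0,1]`. -/
noncomputable def quantile (μ : Measure I) (u : I) : I := sInf {y : I | (u : ℝ) ≤ μ.real (Set.Iic y)}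

/-- Right-continuity of the distribution function makes the infimum attained. The endpoint 1 is
treated apart, having no points to its right. -/
lemma quantile_le_iff (μ : Measure I) [IsProbabilityMeasure μ] (u y : I) :
    quantile μ u ≤ y ↔ (u : ℝ) ≤ μ.real (Set.Iic y) := by
  have hmono : Monotone fun y : I => μ.real (Set.Iic y) := fun a b h =>
    measureReal_mono (Set.Iic_subset_Iic.2 h)
  have hone : μ.real (Set.Iic (1 : I)) = 1 := by
    have : Set.Iic (1 : I) = Set.univ := Set.eq_univ_of_forall fun x => x.2.2
    rw [this, probReal_univ]
  refine ⟨fun h => le_trans ?_ (hmono h), fun h => sInf_le h⟩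
  set z := quantile μ u with hz
  have hgt : ∀ y : I, z < y → (u : ℝ) ≤ μ.real (Set.Iic y) := by
    intro y hy
    obtain ⟨y', hy', hlt⟩ := sInf_lt_iff.1 hy
    exact le_trans hy' (hmono hlt.le)
  by_cases hz1 : z = 1
  · simp only [hz1, hone]; exact u.2.2
  have hne : (nhdsWithin z (Set.Ioi z)).NeBot :=
    nhdsGT_neBot_of_exists_gt ⟨1, lt_of_le_of_ne z.2.2 hz1⟩
  have hc : ∀ x : I, cdf (μ.map Subtype.val) x.1 = μ.real (Set.Iic x) := by
    intro x
    rw [unitInterval.cdf_eq_real]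
    congr 1
    ext y
    simp
  have hcont : Filter.Tendsto (fun y : I => μ.real (Set.Iic y)) (nhdsWithin z (Set.Ioi z))
      (nhds (μ.real (Set.Iic z))) := by
    simp only [← hc]
    have h1 := continuousWithinAt_Ioi_iff_Ici.2 ((cdf (μ.map Subtype.val)).right_continuous z)
    exact h1.tendsto.comp (tendsto_nhdsWithin_of_tendsto_nhds_of_eventually_within _
      (continuous_subtype_val.tendsto z |>.mono_left nhdsWithin_le_nhds)
      (eventually_nhdsWithin_of_forall fun y hy => hy))
  exact ge_of_tendsto hcont (eventually_nhdsWithin_of_forall fun y hy => hgt y hy)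

lemma quantile_mono {μ ν : Measure I} [IsProbabilityMeasure μ] [IsProbabilityMeasure ν]
    (h : ∀ y, ν.real (Set.Iic y) ≤ μ.real (Set.Iic y)) (u : I) : quantile μ u ≤ quantile ν u :=
  (quantile_le_iff μ u _).2 (((quantile_le_iff ν u _).1 le_rfl).trans (h _))

lemma measurable_quantile {X : Type*} [MeasurableSpace X] {μ : X → Measure I}
    [∀ x, IsProbabilityMeasure (μ x)] (hμ : ∀ y, Measurable fun x => (μ x).real (Set.Iic y)) :
    Measurable fun z : X × I => quantile (μ z.1) z.2 := by
  refine measurable_of_Iic fun y => ?_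
  have : (fun z : X × I => quantile (μ z.1) z.2) ⁻¹' Set.Iic y =
      {z | (z.2 : ℝ) ≤ (μ z.1).real (Set.Iic y)} := by
    ext z
    exact quantile_le_iff _ _ _
  rw [this]
  exact measurableSet_le measurable_snd.subtype_val ((hμ y).comp measurable_fst)

lemma map_quantile (μ : Measure I) [IsProbabilityMeasure μ] :
    (volume : Measure I).map (quantile μ) = μ := by
  have hm : Measurable (quantile μ) :=
    (measurable_quantile (μ := fun _ : Unit => μ) fun y => measurable_const).comp
      (measurable_const.prodMk measurable_id : Measurable fun u : I => ((), u))
  have : IsProbabilityMeasure ((volume : Measure I).map (quantile μ)) :=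
    Measure.isProbabilityMeasure_map hm.aemeasurable
  refine Measure.ext_of_Iic _ _ fun y => ?_
  have hI : μ.real (Set.Iic y) ∈ I := ⟨measureReal_nonneg, measureReal_le_one⟩
  rw [Measure.map_apply hm measurableSet_Iic, ← ofReal_measureReal (measure_ne_top μ _)]
  have : quantile μ ⁻¹' Set.Iic y = Set.Iic (⟨_, hI⟩ : I) := by
    ext u
    exact quantile_le_iff _ _ _
  rw [this, unitInterval.volume_Iic]

end Quantile

/-! ### Markov operators and chains driven by random maps -/

section MarkovOperator

variable {X Ω : Type*} [MeasurableSpace X] [MeasurableSpace Ω]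

/-- Bounded measurable real functions. -/
def BddMeas (h : X → ℝ) : Prop := Measurable h ∧ ∃ B, ∀ x, |h x| ≤ B

namespace BddMeas

variable {h g : X → ℝ}

lemma integrable (hh : BddMeas h) (μ : Measure X) [IsFiniteMeasure μ] : Integrable h μ := by
  obtain ⟨hm, B, hB⟩ := hh
  exact Integrable.of_bound hm.aestronglyMeasurable B (Filter.Eventually.of_forall hB)

lemma const (c : ℝ) : BddMeas fun _ : X => c := ⟨measurable_const, |c|, fun _ => le_rfl⟩

lemma add (hh : BddMeas h) (hg : BddMeas g) : BddMeas fun x => h x + g x := by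
  obtain ⟨hm, B, hB⟩ := hh
  obtain ⟨gm, B', hB'⟩ := hg
  exact ⟨hm.add gm, B + B', fun x => (abs_add_le _ _).trans (add_le_add (hB x) (hB' x))⟩

lemma const_mul (hh : BddMeas h) (c : ℝ) : BddMeas fun x => c * h x := by
  obtain ⟨hm, B, hB⟩ := hh
  exact ⟨hm.const_mul c, |c| * B, fun x => by
    rw [abs_mul]; exact mul_le_mul_of_nonneg_left (hB x) (abs_nonneg c)⟩

lemma sub (hh : BddMeas h) (hg : BddMeas g) : BddMeas fun x => h x - g x := by
  simpa [sub_eq_add_neg] using hh.add (hg.const_mul (-1))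

lemma sum {ι : Type*} (s : Finset ι) {h : ι → X → ℝ} (hh : ∀ i, BddMeas (h i)) :
    BddMeas fun x => ∑ i ∈ s, h i x := by
  classical
  induction s using Finset.induction_on with
  | empty => simpa using const 0
  | insert i s hi ih =>
    simp only [Finset.sum_insert hi]
    exact (hh i).add ih

lemma comp {Y : Type*} [MeasurableSpace Y] (hh : BddMeas h) {φ : Y → X} (hφ : Measurable φ) :
    BddMeas fun y => h (φ y) := by
  obtain ⟨hm, B, hB⟩ := hh
  exact ⟨hm.comp hφ, B, fun y => hB _⟩

lemma of_continuous [TopologicalSpace X] [CompactSpace X] [OpensMeasurableSpace X]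
    (hh : Continuous h) : BddMeas h := by
  obtain ⟨B, hB⟩ := isCompact_univ.exists_bound_of_continuousOn hh.continuousOn
  exact ⟨hh.measurable, B, fun x => hB x (Set.mem_univ x)⟩

end BddMeas

/-- The averaging operator of a kernel. -/
noncomputable def markovOp (κ : Kernel X X) (h : X → ℝ) (x : X) : ℝ := ∫ y, h y ∂κ x

instance isMarkovKernel_pow (κ : Kernel X X) [IsMarkovKernel κ] (k : ℕ) : IsMarkovKernel (κ ^ k) := by
  induction k with
  | zero => rw [pow_zero]; exact inferInstanceAs (IsMarkovKernel Kernel.id)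
  | succ k ih => rw [pow_succ]; exact inferInstanceAs (IsMarkovKernel ((κ ^ k) ∘ₖ κ))

variable (κ : Kernel X X) [IsMarkovKernel κ] {h g : X → ℝ}

variable {κ} in
lemma BddMeas.markovOp (hh : BddMeas h) : BddMeas (markovOp κ h) := by
  obtain ⟨hm, B, hB⟩ := hh
  refine ⟨(hm.stronglyMeasurable.integral_kernel (κ := κ)).measurable, B, fun x => ?_⟩
  have := norm_integral_le_of_norm_le_const (μ := κ x) (f := h) (Filter.Eventually.of_forall hB)
  simpa [GibbsNetwork.markovOp] using this

lemma markovOp_const (c : ℝ) : markovOp κ (fun _ => c) = fun _ => c := by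
  funext x; simp [markovOp]

lemma markovOp_add (hh : BddMeas h) (hg : BddMeas g) (x : X) :
    markovOp κ (fun y => h y + g y) x = markovOp κ h x + markovOp κ g x :=
  integral_add (hh.integrable _) (hg.integrable _)

lemma markovOp_sub (hh : BddMeas h) (hg : BddMeas g) (x : X) :
    markovOp κ (fun y => h y - g y) x = markovOp κ h x - markovOp κ g x :=
  integral_sub (hh.integrable _) (hg.integrable _)

omit [IsMarkovKernel κ] in
lemma markovOp_const_mul (c : ℝ) (x : X) :
    markovOp κ (fun y => c * h y) x = c * markovOp κ h x :=
  integral_const_mul _ _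

lemma markovOp_mono (hh : BddMeas h) (hg : BddMeas g) (hle : ∀ x, h x ≤ g x) (x : X) :
    markovOp κ h x ≤ markovOp κ g x :=
  integral_mono (hh.integrable _) (hg.integrable _) hle

omit [IsMarkovKernel κ] in
lemma markovOp_pow_zero (hh : BddMeas h) : markovOp (κ ^ 0) h = h := by
  funext x
  rw [markovOp, pow_zero]
  change ∫ y, h y ∂Kernel.id x = h x
  rw [Kernel.id_apply, integral_dirac' _ _ hh.1.stronglyMeasurable]

/-- This splits off the first step of the chain; the primed version splits off the last one. -/
lemma markovOp_pow_succ (hh : BddMeas h) (k : ℕ) :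
    markovOp (κ ^ (k + 1)) h = markovOp κ (markovOp (κ ^ k) h) := by
  funext x
  rw [markovOp, pow_succ]
  change ∫ y, h y ∂((κ ^ k) ∘ₖ κ) x = _
  exact Kernel.integral_comp (hh.integrable _)

lemma markovOp_pow_succ' (hh : BddMeas h) (k : ℕ) :
    markovOp (κ ^ (k + 1)) h = markovOp (κ ^ k) (markovOp κ h) := by
  funext x
  rw [markovOp, pow_succ']
  change ∫ y, h y ∂(κ ∘ₖ (κ ^ k)) x = _
  exact Kernel.integral_comp (hh.integrable _)

/-- A one-step drift bound controls the mean after `k` steps. -/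
lemma markovOp_pow_le_of_drift (hh : BddMeas h) {c : ℝ} (hc : ∀ x, markovOp κ h x ≤ h x + c) (k : ℕ)
    (x : X) : markovOp (κ ^ k) h x ≤ h x + k * c := by
  induction k generalizing x with
  | zero => rw [markovOp_pow_zero κ hh]; simp
  | succ k ih =>
    rw [markovOp_pow_succ κ hh]
    refine (markovOp_mono κ hh.markovOp (hh.add (BddMeas.const _)) ih x).trans ?_
    rw [markovOp_add κ hh (BddMeas.const _), markovOp_const]
    have := hc x
    push_cast
    linarith

/-- A one-step contraction controls the mean at all times. -/
lemma markovOp_pow_le_of_contraction (hh : BddMeas h) {a c L : ℝ} (ha : 0 ≤ a) (hL : a * L + c ≤ L)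
    (hc : ∀ x, markovOp κ h x ≤ a * h x + c) (k : ℕ) (x : X) (hx : h x ≤ L) :
    markovOp (κ ^ k) h x ≤ L := by
  induction k with
  | zero => rwa [markovOp_pow_zero κ hh]
  | succ k ih =>
    rw [markovOp_pow_succ' κ hh]
    refine (markovOp_mono (κ ^ k) hh.markovOp ((hh.const_mul a).add (BddMeas.const _)) hc x).trans ?_
    rw [markovOp_add (κ ^ k) (hh.const_mul a) (BddMeas.const _), markovOp_const, markovOp_const_mul]
    have := mul_le_mul_of_nonneg_left ih ha
    linarith

omit [MeasurableSpace X] in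
lemma measurable_apply_right {φ : Ω → X → X} {mX : MeasurableSpace X}
    (hφ : Measurable fun z : Ω × X => φ z.1 z.2) (x : X) : Measurable fun ω => φ ω x :=
  hφ.comp measurable_prodMk_right

/-- The kernel of the chain `x ↦ φ ω x` driven by independent copies of `ω`. -/
noncomputable def randomMapKernel (ν : Measure Ω) [SFinite ν] (φ : Ω → X → X)
    (hφ : Measurable fun z : Ω × X => φ z.1 z.2) : Kernel X X where
  toFun x := ν.map fun ω => φ ω x
  measurable' := by
    refine Measure.measurable_of_measurable_coe _ fun s hs => ?_
    have h1 : ∀ x, (ν.map fun ω => φ ω x) s = ν ((fun ω => (x, ω)) ⁻¹'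
        ((fun z : X × Ω => φ z.2 z.1) ⁻¹' s)) := fun x => by
      rw [Measure.map_apply (measurable_apply_right hφ _) hs]; rfl
    simp only [h1]
    exact measurable_measure_prodMk_left ((hφ.comp measurable_swap) hs)

section RandomMap

variable (ν : Measure Ω) [IsProbabilityMeasure ν] (φ : Ω → X → X)
  (hφ : Measurable fun z : Ω × X => φ z.1 z.2)

lemma randomMapKernel_apply (x : X) : randomMapKernel ν φ hφ x = ν.map fun ω => φ ω x := rfl

instance isMarkovKernel_randomMapKernel : IsMarkovKernel (randomMapKernel ν φ hφ) :=
  ⟨fun _ => Measure.isProbabilityMeasure_map (measurable_apply_right hφ _).aemeasurable⟩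

lemma markovOp_randomMapKernel (hh : BddMeas h) (x : X) :
    markovOp (randomMapKernel ν φ hφ) h x = ∫ ω, h (φ ω x) ∂ν := by
  rw [markovOp, randomMapKernel_apply, integral_map (measurable_apply_right hφ _).aemeasurable
    hh.1.aestronglyMeasurable]

/-- If every map preserves `R` and `h` is monotone along `R`, then so is its average. -/
lemma markovOp_randomMapKernel_pow_mono {R : X → X → Prop}
    (hR : ∀ ω x y, R x y → R (φ ω x) (φ ω y)) (hh : BddMeas h) (hg : BddMeas g)
    (hmono : ∀ x y, R x y → h x ≤ g y) (k : ℕ) {x y : X} (hxy : R x y) :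
    markovOp (randomMapKernel ν φ hφ ^ k) h x ≤ markovOp (randomMapKernel ν φ hφ ^ k) g y := by
  induction k generalizing x y with
  | zero => rw [markovOp_pow_zero _ hh, markovOp_pow_zero _ hg]; exact hmono x y hxy
  | succ k ih =>
    rw [markovOp_pow_succ _ hh, markovOp_pow_succ _ hg, markovOp_randomMapKernel _ _ _ hh.markovOp,
      markovOp_randomMapKernel _ _ _ hg.markovOp]
    exact integral_mono ((hh.markovOp.comp (measurable_apply_right hφ _)).integrable _)
      ((hg.markovOp.comp (measurable_apply_right hφ _)).integrable _) fun ω => ih (hR ω x y hxy)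

omit hφ in
lemma measurable_pairMap (hφ : Measurable fun z : Ω × X => φ z.1 z.2) :
    Measurable fun z : Ω × (X × X) => (φ z.1 z.2.1, φ z.1 z.2.2) :=
  (hφ.comp (measurable_fst.prodMk measurable_snd.fst)).prodMk
    (hφ.comp (measurable_fst.prodMk measurable_snd.snd))

/-- Two chains driven by the same noise. -/
noncomputable def pairKernel : Kernel (X × X) (X × X) :=
  randomMapKernel ν (fun ω z => (φ ω z.1, φ ω z.2)) (measurable_pairMap φ hφ)

instance isMarkovKernel_pairKernel : IsMarkovKernel (pairKernel ν φ hφ) :=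
  isMarkovKernel_randomMapKernel _ _ _

lemma pairKernel_apply (z : X × X) :
    pairKernel ν φ hφ z = ν.map fun ω => (φ ω z.1, φ ω z.2) := rfl

/-- Each component of the pair, seen through a projection intertwining the maps, is the chain. -/
lemma pairKernel_pow_map {π : X × X → X} (hπ : Measurable π)
    (hint : ∀ ω z, π (φ ω z.1, φ ω z.2) = φ ω (π z)) (k : ℕ) (z : X × X) :
    ((pairKernel ν φ hφ ^ k) z).map π = (randomMapKernel ν φ hφ ^ k) (π z) := by
  induction k generalizing z with
  | zero =>
    simp only [pow_zero]
    change (Kernel.id z).map π = Kernel.id (π z)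
    rw [Kernel.id_apply, Kernel.id_apply, Measure.map_dirac' hπ]
  | succ k ih =>
    ext s hs
    rw [Measure.map_apply hπ hs, pow_succ, pow_succ]
    change (((pairKernel ν φ hφ) ^ k) ∘ₖ (pairKernel ν φ hφ)) z (π ⁻¹' s) =
      ((randomMapKernel ν φ hφ ^ k) ∘ₖ (randomMapKernel ν φ hφ)) (π z) s
    rw [Kernel.comp_apply' _ _ _ (hπ hs), Kernel.comp_apply' _ _ _ hs, pairKernel_apply,
      randomMapKernel_apply,
      lintegral_map (Kernel.measurable_coe _ (hπ hs))
        (measurable_apply_right (φ := fun ω (z : X × X) => (φ ω z.1, φ ω z.2))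
          (measurable_pairMap φ hφ) z),
      lintegral_map (Kernel.measurable_coe _ hs) (measurable_apply_right hφ _)]
    refine lintegral_congr fun ω => ?_
    rw [← hint, ← ih, Measure.map_apply hπ hs]

end RandomMap

end MarkovOperator

/-! ### The Gibbs sampler as a monotone random map -/

namespace Network

variable {d : ℕ} (C : Network d)

/-- The weighted average of a configuration. -/
noncomputable def mean (p : Fin d → I) : ℝ := C.wmean fun i => (p i : ℝ)

/-- The weighted average of a configuration over the neighbours of `i`. -/
noncomputable def localMean (i : Fin d) (p : Fin d → I) : ℝ := C.nbrMean (fun j => (p j : ℝ)) i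

lemma coe_update (p : Fin d → I) (i : Fin d) (x : I) :
    (fun j => (Function.update p i x j : ℝ)) = Function.update (fun j => (p j : ℝ)) i (x : ℝ) := by
  funext j
  by_cases h : j = i
  · subst h; simp
  · simp [h]

lemma measurable_localMean (i : Fin d) : Measurable (C.localMean i) := by
  unfold localMean nbrMean
  fun_prop

lemma energy_update (hc : ∀ i, 0 < C.vertexWeight i) (p : Fin d → I) (i : Fin d) (x : I) :
    C.energy (Function.update p i x) = C.energy p +
      C.vertexWeight i * ((x : ℝ) - C.localMean i p) ^ 2 -
        C.vertexWeight i * ((p i : ℝ) - C.localMean i p) ^ 2 := by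
  rw [energy_eq, coe_update, C.dirichlet_update hc, energy_eq, localMean]

lemma condLaw_eq (hc : ∀ i, 0 < C.vertexWeight i) (A : ℝ) (i : Fin d) (p : Fin d → I) :
    C.condLaw A i p = truncGauss (A ^ 2 * C.vertexWeight i) (C.localMean i p) := by
  rw [condLaw, truncGauss, ← tilted_add_const _ _
    (A ^ 2 * (C.energy p - C.vertexWeight i * ((p i : ℝ) - C.localMean i p) ^ 2))]
  congr 1
  funext x
  rw [C.energy_update hc]
  ring

lemma mean_update (p : Fin d → I) (i : Fin d) (x : I) :
    C.mean (Function.update p i x) = C.mean p + C.vertexWeight i * ((x : ℝ) - p i) := by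
  have h : ∀ j, C.vertexWeight j * (Function.update p i x j : ℝ) = C.vertexWeight j * (p j : ℝ) +
      if j = i then C.vertexWeight i * ((x : ℝ) - p i) else 0 := by
    intro j
    by_cases hj : j = i
    · subst hj; simp; ring
    · simp [hj]
  simp only [mean, wmean, h, Finset.sum_add_distrib, Finset.sum_ite_eq', Finset.mem_univ, if_true]

lemma continuous_mean : Continuous C.mean := by
  unfold mean wmean; fun_prop

lemma mean_const (hu : C.UnitTotalWeight) (a : I) : C.mean (fun _ => a) = a := by
  rw [mean, wmean, ← Finset.sum_mul, C.sum_vertexWeight hu, one_mul]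

lemma monotone_mean : Monotone C.mean := by
  intro p q h
  unfold mean wmean
  exact Finset.sum_le_sum fun i _ => mul_le_mul_of_nonneg_left (show (p i : ℝ) ≤ q i from h i)
    (C.vertexWeight_nonneg i)

lemma monotone_localMean (hc : ∀ i, 0 < C.vertexWeight i) (i : Fin d) : Monotone (C.localMean i) :=
  fun _ _ h => C.nbrMean_mono hc (fun j => h j) i

lemma mean_mem (hu : C.UnitTotalWeight) (p : Fin d → I) : 0 ≤ C.mean p ∧ C.mean p ≤ 1 := by
  have h0 := C.mean_const hu 0
  have h1 := C.mean_const hu 1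
  have h2 := C.monotone_mean (show (fun _ => (0 : I)) ≤ p from fun i => (p i).2.1)
  have h3 := C.monotone_mean (show p ≤ (fun _ => (1 : I)) from fun i => (p i).2.2)
  rw [h0] at h2
  rw [h1] at h3
  exact ⟨by simpa using h2, by simpa using h3⟩

lemma energy_const (a : I) : C.energy (fun _ => a) = 0 := by simp [energy]

lemma energy_nonneg (p : Fin d → I) : 0 ≤ C.energy p := by
  rw [energy_eq]; exact C.dirichlet_nonneg _

section Kernel

variable [NeZero d]

instance isMarkovKernel_gibbs (A : ℝ) : IsMarkovKernel (C.gibbs A) := by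
  refine ⟨fun p => ⟨?_⟩⟩
  have h : ∀ i, ((C.condLaw A i p).map (Function.update p i)) Set.univ = 1 := fun i => by
    have := C.isProbabilityMeasure_condLaw A i p
    have := Measure.isProbabilityMeasure_map (μ := C.condLaw A i p)
      (measurable_update p (a := i)).aemeasurable
    exact measure_univ
  change (∑ i, (d : ℝ≥0∞)⁻¹ • (C.condLaw A i p).map (Function.update p i)) Set.univ = 1
  simp only [Measure.coe_finsetSum, Finset.sum_apply, Measure.smul_apply, h]
  simp [ENNReal.mul_inv_cancel (Nat.cast_ne_zero.2 (NeZero.ne d)) (ENNReal.natCast_ne_top d)]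

lemma markovOp_gibbs (hc : ∀ i, 0 < C.vertexWeight i) (A : ℝ) {h : (Fin d → I) → ℝ}
    (hh : BddMeas h) (p : Fin d → I) :
    markovOp (C.gibbs A) h p = (d : ℝ)⁻¹ * ∑ i, ∫ x : I, h (Function.update p i x)
      ∂truncGauss (A ^ 2 * C.vertexWeight i) (C.localMean i p) := by
  change ∫ q, h q ∂(∑ i, (d : ℝ≥0∞)⁻¹ • (C.condLaw A i p).map (Function.update p i)) = _
  have hprob : ∀ i, IsProbabilityMeasure ((C.condLaw A i p).map (Function.update p i)) := fun i => by
    have := C.isProbabilityMeasure_condLaw A i p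
    exact Measure.isProbabilityMeasure_map (measurable_update p).aemeasurable
  rw [integral_finsetSum_measure fun i _ => (hh.integrable _).smul_measure
    (ENNReal.inv_ne_top.2 (Nat.cast_ne_zero.2 (NeZero.ne d))), Finset.mul_sum]
  refine Finset.sum_congr rfl fun i _ => ?_
  rw [integral_smul_measure, integral_map (measurable_update p).aemeasurable
    hh.1.aestronglyMeasurable, C.condLaw_eq hc]
  simp

/-- The law of the uniform vertex and the uniform variable driving one step of the sampler. -/
noncomputable def noise (d : ℕ) : Measure (Fin d × I) :=
  ∑ i, (d : ℝ≥0∞)⁻¹ • (volume : Measure I).map (Prod.mk i)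

omit [NeZero d] in
lemma noise_apply {s : Set (Fin d × I)} (hs : MeasurableSet s) :
    noise d s = ∑ i, (d : ℝ≥0∞)⁻¹ * (volume : Measure I) (Prod.mk i ⁻¹' s) := by
  simp only [noise, Measure.coe_finsetSum, Finset.sum_apply, Measure.smul_apply, smul_eq_mul]
  exact Finset.sum_congr rfl fun i _ => by rw [Measure.map_apply measurable_prodMk_left hs]

instance isProbabilityMeasure_noise : IsProbabilityMeasure (noise d) := by
  refine ⟨?_⟩
  rw [noise_apply MeasurableSet.univ]
  simp [ENNReal.mul_inv_cancel (Nat.cast_ne_zero.2 (NeZero.ne d)) (ENNReal.natCast_ne_top d)]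

/-- The random map driving the sampler. -/
noncomputable def gibbsMap (A : ℝ) (ω : Fin d × I) (p : Fin d → I) : Fin d → I :=
  Function.update p ω.1
    (quantile (truncGauss (A ^ 2 * C.vertexWeight ω.1) (C.localMean ω.1 p)) ω.2)

omit [NeZero d] in
lemma measurable_gibbsMap (A : ℝ) :
    Measurable fun z : (Fin d × I) × (Fin d → I) => C.gibbsMap A z.1 z.2 := by
  have hq : Measurable fun z : (Fin d × (Fin d → I)) × I =>
      quantile (truncGauss (A ^ 2 * C.vertexWeight z.1.1) (C.localMean z.1.1 z.1.2)) z.2 := by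
    refine measurable_quantile (μ := fun z : Fin d × (Fin d → I) =>
      truncGauss (A ^ 2 * C.vertexWeight z.1) (C.localMean z.1 z.2)) fun y => ?_
    refine measurable_from_prod_countable_right fun i => ?_
    exact (truncGauss_Iic_antitone (mul_nonneg (sq_nonneg A)
      (C.vertexWeight_nonneg i)) y).measurable.comp (C.measurable_localMean i)
  have hq' := hq.comp ((measurable_fst.fst.prodMk measurable_snd).prodMk measurable_fst.snd :
    Measurable fun z : (Fin d × I) × (Fin d → I) => ((z.1.1, z.2), z.1.2))
  refine measurable_pi_iff.2 fun j => ?_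
  have : (fun z : (Fin d × I) × (Fin d → I) => C.gibbsMap A z.1 z.2 j) = fun z =>
      if z.1.1 = j then
        quantile (truncGauss (A ^ 2 * C.vertexWeight z.1.1) (C.localMean z.1.1 z.2)) z.1.2
      else z.2 j := by
    funext z
    by_cases h : z.1.1 = j
    · subst h; simp [gibbsMap]
    · rw [if_neg h, gibbsMap, Function.update_of_ne (Ne.symm h)]
  rw [this]
  exact Measurable.ite (measurable_fst.fst (measurableSet_singleton j)) hq'
    ((measurable_pi_apply j).comp measurable_snd)

omit [NeZero d] in
-- A larger configuration has larger local means, hence stochastically larger conditional laws,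
-- hence larger quantiles at the same uniform variable.
lemma gibbsMap_mono (hc : ∀ i, 0 < C.vertexWeight i) (A : ℝ) (ω : Fin d × I) :
    Monotone (C.gibbsMap A ω) := by
  intro p q h j
  by_cases hj : j = ω.1
  · subst hj
    simp only [gibbsMap, Function.update_self]
    exact quantile_mono (fun y => truncGauss_Iic_antitone (mul_nonneg (sq_nonneg A)
      (C.vertexWeight_nonneg _)) y (C.monotone_localMean hc _ h)) _
  · simp only [gibbsMap, Function.update_of_ne hj]
    exact h j

lemma gibbs_eq_randomMapKernel (hc : ∀ i, 0 < C.vertexWeight i) (A : ℝ) :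
    C.gibbs A = randomMapKernel (noise d) (C.gibbsMap A) (C.measurable_gibbsMap A) := by
  ext p s hs
  change (∑ i, (d : ℝ≥0∞)⁻¹ • (C.condLaw A i p).map (Function.update p i)) s = _
  have hm := measurable_apply_right (C.measurable_gibbsMap A) p
  rw [randomMapKernel_apply, Measure.map_apply hm hs, noise_apply (hm hs)]
  simp only [Measure.coe_finsetSum, Finset.sum_apply, Measure.smul_apply, smul_eq_mul]
  refine Finset.sum_congr rfl fun i _ => ?_
  have hq : Measurable (quantile (truncGauss (A ^ 2 * C.vertexWeight i) (C.localMean i p))) :=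
    (measurable_quantile (μ := fun _ : Unit => truncGauss (A ^ 2 * C.vertexWeight i)
      (C.localMean i p)) fun y => measurable_const).comp
      (measurable_const.prodMk measurable_id : Measurable fun u : I => ((), u))
  rw [Measure.map_apply (measurable_update p) hs, C.condLaw_eq hc, ← map_quantile (truncGauss _ _),
    Measure.map_apply hq (measurable_update p hs)]
  rfl

lemma markovOp_gibbs_pow_monotone (hc : ∀ i, 0 < C.vertexWeight i) (A : ℝ) {h : (Fin d → I) → ℝ}
    (hh : BddMeas h) (hm : Monotone h) (k : ℕ) : Monotone (markovOp (C.gibbs A ^ k) h) := by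
  rw [C.gibbs_eq_randomMapKernel hc]
  exact fun p q hpq => markovOp_randomMapKernel_pow_mono (noise d) (C.gibbsMap A) _
    (R := fun p q => p ≤ q) (fun ω p q h => C.gibbsMap_mono hc A ω h) hh hh
    (fun p q h => hm h) k hpq

end Kernel

/-! ### Invariance of the target measure -/

section Invariance

/-- Fubini in coordinate i: the joint density is the density of the other coordinates times the
conditional density, and the resampling probability does not depend on the coordinate being
replaced. -/
lemma lintegral_condLaw_map (A : ℝ) (i : Fin d) {s : Set (Fin d → I)} (hs : MeasurableSet s) :
    ∫⁻ p, (C.condLaw A i p).map (Function.update p i) s ∂C.target A = C.target A s := by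
  set f : (Fin d → I) → ℝ := fun p => -A ^ 2 * C.energy p with hf
  have hfc : Continuous f := by
    have := C.continuous_energy
    fun_prop
  have hup : ∀ p : Fin d → I, Continuous fun y : I => Function.update p i y := fun p =>
    continuous_const.update i continuous_id
  set Z : ℝ := ∫ p, Real.exp (f p) with hZ
  set Zi : (Fin d → I) → ℝ := fun p => ∫ y : I, Real.exp (f (Function.update p i y)) with hZi
  have hZi_pos : ∀ p, 0 < Zi p := fun p =>
    integral_exp_pos (integrable_of_continuous (by have := hup p; fun_prop))
  set v : (Fin d → I) → ℝ≥0∞ := fun p => ENNReal.ofReal (Real.exp (f p) / Z) with hv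
  have hvm : Measurable v := by have := hfc.measurable; fun_prop
  set R : (Fin d → I) → ℝ≥0∞ := fun p => (C.condLaw A i p).map (Function.update p i) s with hR
  have hRm : Measurable R := (Measure.measurable_coe hs).comp (C.measurable_condLaw_map A i)
  have hRu : ∀ p y, R (Function.update p i y) = R p := by
    intro p y
    have : Function.update (Function.update p i y) i = Function.update p i := by
      funext x; simp
    simp only [hR, condLaw, this]
  have hR_eq : ∀ p, R p = ∫⁻ x : I, ENNReal.ofReal (Real.exp (f (Function.update p i x)) / Zi p) *
      s.indicator 1 (Function.update p i x) := by
    intro p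
    simp only [hR]
    rw [Measure.map_apply (measurable_update p) hs,
      ← lintegral_indicator_one (measurable_update p hs), condLaw, lintegral_tilted]
    rfl
  have hpi : C.target A s = ∫⁻ p, v p * s.indicator 1 p := by
    rw [← lintegral_indicator_one hs, target, lintegral_tilted]
  have hpR : ∫⁻ p, R p ∂C.target A = ∫⁻ p, v p * R p := by
    rw [target, lintegral_tilted]
  rw [hpR, hpi]
  refine lintegral_eq_of_lmarginal_eq {i} (hvm.mul hRm)
    (hvm.mul (measurable_one.indicator hs)) ?_
  funext p
  rw [lmarginal_singleton, lmarginal_singleton]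
  simp only [hRu]
  rw [lintegral_mul_const (R p) (f := fun y => v (Function.update p i y))
    (hvm.comp (measurable_update p)), hR_eq]
  have hvi : ∫⁻ y : I, v (Function.update p i y) = ENNReal.ofReal (Zi p / Z) := by
    simp only [hv]
    rw [← ofReal_integral_eq_lintegral_ofReal (integrable_of_continuous (by
      have := hup p; fun_prop)) (Filter.Eventually.of_forall fun y => div_nonneg (Real.exp_pos _).le
        (integral_nonneg fun _ => (Real.exp_pos _).le)), integral_div]
  rw [hvi, ← lintegral_const_mul]
  · refine lintegral_congr fun x => ?_
    rw [← mul_assoc, ← ENNReal.ofReal_mul (div_nonneg (hZi_pos p).le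
      (integral_nonneg fun _ => (Real.exp_pos _).le))]
    rw [mul_comm (Zi p / Z), div_mul_div_cancel₀ (hZi_pos p).ne']
  · refine Measurable.mul ?_ ((measurable_one.indicator hs).comp (measurable_update p))
    have := hup p
    exact Measurable.ennreal_ofReal (Continuous.measurable (by fun_prop))

lemma gibbs_invariant [NeZero d] (A : ℝ) : (C.gibbs A).Invariant (C.target A) := by
  refine Measure.ext fun s hs => ?_
  rw [Measure.bind_apply hs (Kernel.aemeasurable _)]
  have h : ∀ p, C.gibbs A p s = ∑ i, (d : ℝ≥0∞)⁻¹ * (C.condLaw A i p).map (Function.update p i) s := by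
    intro p
    change (∑ i, (d : ℝ≥0∞)⁻¹ • (C.condLaw A i p).map (Function.update p i)) s = _
    simp only [Measure.coe_finsetSum, Finset.sum_apply, Measure.smul_apply, smul_eq_mul]
  have hm : ∀ i, Measurable fun p => (C.condLaw A i p).map (Function.update p i) s := fun i =>
    (Measure.measurable_coe hs).comp (C.measurable_condLaw_map A i)
  simp only [h]
  rw [lintegral_finsetSum _ fun i _ => (hm i).const_mul _]
  simp only [lintegral_const_mul _ (hm _), C.lintegral_condLaw_map A _ hs]
  rw [Finset.sum_const, Finset.card_univ, Fintype.card_fin, nsmul_eq_mul, ← mul_assoc,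
    ENNReal.mul_inv_cancel (Nat.cast_ne_zero.2 (NeZero.ne d)) (ENNReal.natCast_ne_top d), one_mul]

lemma gibbs_pow_invariant [NeZero d] (A : ℝ) (k : ℕ) : (C.gibbs A ^ k).Invariant (C.target A) := by
  induction k with
  | zero =>
    rw [pow_zero]
    exact Measure.bind_dirac (m := C.target A)
  | succ k ih => rw [pow_succ]; exact ih.comp (C.gibbs_invariant A)

end Invariance

/-! ### One-step drifts of the mean and of the energy -/

section Drift

variable (hc : ∀ i, 0 < C.vertexWeight i) {A : ℝ}

lemma bddMeas_mean : BddMeas C.mean := BddMeas.of_continuous C.continuous_mean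

lemma bddMeas_energy : BddMeas C.energy := BddMeas.of_continuous C.continuous_energy

lemma bddMeas_sq_mean_sub (a : ℝ) : BddMeas fun p => (C.mean p - a) ^ 2 :=
  BddMeas.of_continuous (by have := C.continuous_mean; fun_prop)

lemma sum_vertexWeight_mul_localMean (hc : ∀ i, 0 < C.vertexWeight i) (p : Fin d → I) :
    ∑ i, C.vertexWeight i * C.localMean i p = C.mean p :=
  C.sum_vertexWeight_mul_nbrMean hc _

variable [NeZero d]

include hc

omit hc in
lemma inv_mul_sum_add (a : ℝ) (f : Fin d → ℝ) :
    (d : ℝ)⁻¹ * ∑ i, (a + f i) = a + (d : ℝ)⁻¹ * ∑ i, f i := by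
  have : (d : ℝ) ≠ 0 := Nat.cast_ne_zero.2 (NeZero.ne d)
  rw [Finset.sum_add_distrib, mul_add]
  simp [this]

/-- The jumps towards the neighbour means cancel in the weighted sum, because averaging over
neighbours preserves the weighted mean. Only the truncation drift survives. -/
lemma markovOp_gibbs_mean (p : Fin d → I) :
    markovOp (C.gibbs A) C.mean p = C.mean p + (d : ℝ)⁻¹ *
      ∑ i, C.vertexWeight i * truncDrift (A ^ 2 * C.vertexWeight i) (C.localMean i p) := by
  rw [C.markovOp_gibbs hc A C.bddMeas_mean]
  have h : ∀ i, ∫ x : I, C.mean (Function.update p i x)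
      ∂truncGauss (A ^ 2 * C.vertexWeight i) (C.localMean i p) =
      C.mean p + (C.vertexWeight i * truncDrift (A ^ 2 * C.vertexWeight i) (C.localMean i p) +
        (C.vertexWeight i * C.localMean i p - C.vertexWeight i * p i)) := by
    intro i
    simp only [mean_update]
    rw [integral_add (integrable_const _) (integrable_of_continuous (by fun_prop)),
      integral_const_mul, integral_sub (integrable_of_continuous (by fun_prop))
      (integrable_const _), integral_truncGauss_id]
    simp
    ring
  have h2 : ∑ i, (C.vertexWeight i * C.localMean i p - C.vertexWeight i * p i) = 0 := by
    rw [Finset.sum_sub_distrib, C.sum_vertexWeight_mul_localMean hc]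
    exact sub_self _
  simp only [h]
  rw [inv_mul_sum_add, Finset.sum_add_distrib, h2, add_zero]

lemma markovOp_gibbs_sq_mean (a : ℝ) (p : Fin d → I) :
    markovOp (C.gibbs A) (fun q => (C.mean q - a) ^ 2) p = (C.mean p - a) ^ 2 +
      2 * (C.mean p - a) * ((d : ℝ)⁻¹ * ∑ i, C.vertexWeight i *
        truncDrift (A ^ 2 * C.vertexWeight i) (C.localMean i p)) +
      (d : ℝ)⁻¹ * ∑ i, C.vertexWeight i ^ 2 * ∫ x : I, ((x : ℝ) - p i) ^ 2
        ∂truncGauss (A ^ 2 * C.vertexWeight i) (C.localMean i p) := by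
  have h1 := C.markovOp_gibbs_mean hc (A := A) p
  have h3 : ∀ q, (C.mean q - a) ^ 2 = ((C.mean p - a) ^ 2 +
      2 * (C.mean p - a) * (C.mean q - C.mean p)) + (C.mean q - C.mean p) ^ 2 := fun q => by ring
  have hlin : BddMeas fun q => 2 * (C.mean p - a) * (C.mean q - C.mean p) :=
    (C.bddMeas_mean.sub (BddMeas.const _)).const_mul _
  have h4 : markovOp (C.gibbs A) (fun q => (C.mean q - a) ^ 2) p = (C.mean p - a) ^ 2 +
      2 * (C.mean p - a) * (markovOp (C.gibbs A) C.mean p - C.mean p) +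
        markovOp (C.gibbs A) (fun q => (C.mean q - C.mean p) ^ 2) p := by
    rw [funext h3, markovOp_add _ ((BddMeas.const _).add hlin) (C.bddMeas_sq_mean_sub _),
      markovOp_add _ (BddMeas.const _) hlin, markovOp_const, markovOp_const_mul,
      markovOp_sub _ C.bddMeas_mean (BddMeas.const _), markovOp_const]
  rw [h4, h1, C.markovOp_gibbs hc A (C.bddMeas_sq_mean_sub _)]
  simp only [mean_update, add_sub_cancel_left, mul_pow, integral_const_mul]

omit [NeZero d] in
-- Each jump is split into the fluctuation about the local mean, contributing 1/A² in total, and the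
-- displacement of p_i from its local mean, which sums to the dissipation.
lemma sum_sq_mul_integral_le (hu : C.UnitTotalWeight) (hA : 0 < A) {g : ℝ}
    (hg : ∀ i, C.vertexWeight i ≤ g) (p : Fin d → I) :
    ∑ i, C.vertexWeight i ^ 2 * ∫ x : I, ((x : ℝ) - p i) ^ 2
        ∂truncGauss (A ^ 2 * C.vertexWeight i) (C.localMean i p) ≤
      1 / A ^ 2 + 2 * g * C.dissip fun i => (p i : ℝ) := by
  have h : ∀ i, C.vertexWeight i ^ 2 * ∫ x : I, ((x : ℝ) - p i) ^ 2
      ∂truncGauss (A ^ 2 * C.vertexWeight i) (C.localMean i p) ≤ C.vertexWeight i * (1 / A ^ 2) +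
        2 * g * (C.vertexWeight i * ((p i : ℝ) - C.localMean i p) ^ 2) := by
    intro i
    have hi := hc i
    have hm := C.nbrMean_mem hc p i
    have e1 : ∫ x : I, ((x : ℝ) - p i) ^ 2
        ∂truncGauss (A ^ 2 * C.vertexWeight i) (C.localMean i p) ≤
        ∫ x : I, (2 * ((x : ℝ) - C.localMean i p) ^ 2 + 2 * ((p i : ℝ) - C.localMean i p) ^ 2)
        ∂truncGauss (A ^ 2 * C.vertexWeight i) (C.localMean i p) := by
      refine integral_mono (integrable_of_continuous (by fun_prop))
        (integrable_of_continuous (by fun_prop)) fun x => ?_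
      simp only
      nlinarith [sq_nonneg (((x : ℝ) - C.localMean i p) + ((p i : ℝ) - C.localMean i p))]
    rw [integral_add (integrable_of_continuous (by fun_prop)) (integrable_const _),
      integral_const_mul] at e1
    have e2 := integral_sq_truncGauss_le (by positivity : 0 < A ^ 2 * C.vertexWeight i) hm.1 hm.2
    change ∫ x : I, ((x : ℝ) - C.localMean i p) ^ 2 ∂truncGauss _ (C.localMean i p) ≤ _ at e2
    simp only [integral_const, probReal_univ, smul_eq_mul, one_mul] at e1
    calc _ ≤ C.vertexWeight i ^ 2 * (2 * (1 / (2 * (A ^ 2 * C.vertexWeight i))) +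
          2 * ((p i : ℝ) - C.localMean i p) ^ 2) := by gcongr; linarith
      _ = C.vertexWeight i * (1 / A ^ 2) + 2 * C.vertexWeight i *
          (C.vertexWeight i * ((p i : ℝ) - C.localMean i p) ^ 2) := by field_simp
      _ ≤ _ := by have := hg i; gcongr
  refine (Finset.sum_le_sum fun i _ => h i).trans_eq ?_
  rw [Finset.sum_add_distrib, ← Finset.sum_mul, C.sum_vertexWeight hu, one_mul, ← Finset.mul_sum]
  rfl

omit [NeZero d] in
-- A lower bound on the fluctuations of the mean, uniform in the configuration; it is what
-- eventually forces the chains together.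
lemma le_sum_sq_mul_integral (hu : C.UnitTotalWeight) (hA : 0 < A)
    (hs : ∀ i, 4 ≤ A ^ 2 * C.vertexWeight i) (p : Fin d → I) :
    1 / (100 * A ^ 2) ≤ ∑ i, C.vertexWeight i ^ 2 * ∫ x : I, ((x : ℝ) - p i) ^ 2
        ∂truncGauss (A ^ 2 * C.vertexWeight i) (C.localMean i p) := by
  have h : ∀ i, C.vertexWeight i * (1 / (100 * A ^ 2)) ≤
      C.vertexWeight i ^ 2 * ∫ x : I, ((x : ℝ) - p i) ^ 2
        ∂truncGauss (A ^ 2 * C.vertexWeight i) (C.localMean i p) := by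
    intro i
    have hi := hc i
    have hm := C.nbrMean_mem hc p i
    have e := le_integral_sq_truncGauss (hs i) hm.1 hm.2 (p i : ℝ)
    calc _ = C.vertexWeight i ^ 2 * (1 / (100 * (A ^ 2 * C.vertexWeight i))) := by field_simp
      _ ≤ _ := mul_le_mul_of_nonneg_left e (sq_nonneg _)
  refine Eq.trans_le ?_ (Finset.sum_le_sum fun i _ => h i)
  rw [← Finset.sum_mul, C.sum_vertexWeight hu, one_mul]

/-- Resampling coordinate i removes c_i (p_i - local mean)² and puts back c_i times a second moment
of at most 1/(2A²c_i). The negative dissipation term is the currency for all later error terms. -/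
lemma markovOp_gibbs_energy_le (hA : 0 < A) (p : Fin d → I) :
    markovOp (C.gibbs A) C.energy p ≤ C.energy p + 1 / (2 * A ^ 2) -
      (d : ℝ)⁻¹ * C.dissip fun i => (p i : ℝ) := by
  rw [C.markovOp_gibbs hc A C.bddMeas_energy]
  have h : ∀ i, ∫ x : I, C.energy (Function.update p i x)
      ∂truncGauss (A ^ 2 * C.vertexWeight i) (C.localMean i p) ≤
      C.energy p + 1 / (2 * A ^ 2) + -(C.vertexWeight i * ((p i : ℝ) - C.localMean i p) ^ 2) := by
    intro i
    have hi := hc i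
    have hm := C.nbrMean_mem hc p i
    have e2 := integral_sq_truncGauss_le (by positivity : 0 < A ^ 2 * C.vertexWeight i) hm.1 hm.2
    change ∫ x : I, ((x : ℝ) - C.localMean i p) ^ 2 ∂truncGauss _ (C.localMean i p) ≤ _ at e2
    simp only [C.energy_update hc]
    rw [integral_sub (integrable_of_continuous (by fun_prop)) (integrable_const _),
      integral_add (integrable_const _) (integrable_of_continuous (by fun_prop)),
      integral_const_mul]
    have e3 := mul_le_mul_of_nonneg_left e2 hi.le
    have e4 : C.vertexWeight i * (1 / (2 * (A ^ 2 * C.vertexWeight i))) = 1 / (2 * A ^ 2) := by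
      field_simp
    simp only [integral_const, probReal_univ, smul_eq_mul, one_mul]
    linarith
  refine (mul_le_mul_of_nonneg_left (Finset.sum_le_sum fun i _ => h i) (by positivity)).trans_eq ?_
  rw [inv_mul_sum_add, Finset.sum_neg_distrib, mul_neg, ← sub_eq_add_neg]
  rfl

omit hc [NeZero d] in
/-- The drift of the mean, tested against a direction which is harmless near the boundary. -/
lemma drift_mul_le (hd : 2 ≤ d) (hC : C.IsConnected) (hu : C.UnitTotalWeight) (hA : 0 < A)
    {r y : ℝ} (hr : 0 < r) (hr2 : r ≤ 1 / 2) (hy : |y| ≤ 1) (p : Fin d → I)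
    (hlo : ∀ m, m < r → 0 < y → r ≤ C.mean p - m) (hhi : ∀ m, 1 - r < m → y < 0 → r ≤ m - C.mean p) :
    2 * y * ((d : ℝ)⁻¹ * ∑ i, C.vertexWeight i *
        truncDrift (A ^ 2 * C.vertexWeight i) (C.localMean i p)) ≤
      4 / (r ^ 3 * A ^ 4 * C.beta) + 2 / (A * √C.beta * C.gap ^ 2 * r ^ 2) *
        ((d : ℝ)⁻¹ * C.dissip fun i => (p i : ℝ)) := by
  have hc := C.vertexWeight_pos hd hC
  have hb := C.beta_pos hd hC
  have hg := C.gap_pos hd hC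
  have hd0 : (0 : ℝ) < d := Nat.cast_pos.2 (by omega)
  have hsb : 0 < √C.beta := Real.sqrt_pos.2 hb
  have h : ∀ i, C.vertexWeight i * truncDrift (A ^ 2 * C.vertexWeight i) (C.localMean i p) * y ≤
      2 / (r ^ 3 * A ^ 4 * C.beta) +
        C.vertexWeight i * (C.mean p - C.localMean i p) ^ 2 * (1 / (A * √C.beta * r ^ 2)) := by
    intro i
    have hi := hc i
    have hbi := C.beta_le i
    have hm := C.nbrMean_mem hc p i
    have e := truncDrift_mul_le (by positivity : 0 < A ^ 2 * C.vertexWeight i) hm.1 hm.2 hr hr2 hy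
      (hlo _) (hhi _)
    change truncDrift _ (C.localMean i p) * y ≤ _ + (C.mean p - C.localMean i p) ^ 2 / _ at e
    have hsq : √(A ^ 2 * C.vertexWeight i) = A * √(C.vertexWeight i) := by
      rw [Real.sqrt_mul (sq_nonneg A), Real.sqrt_sq hA.le]
    rw [hsq] at e
    have hsi : √C.beta ≤ √(C.vertexWeight i) := Real.sqrt_le_sqrt hbi
    calc _ = C.vertexWeight i *
          (truncDrift (A ^ 2 * C.vertexWeight i) (C.localMean i p) * y) := by ring
      _ ≤ C.vertexWeight i * (2 / ((A ^ 2 * C.vertexWeight i) ^ 2 * r ^ 3) +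
          (C.mean p - C.localMean i p) ^ 2 / (A * √(C.vertexWeight i) * r ^ 2)) :=
          mul_le_mul_of_nonneg_left e hi.le
      _ = 2 / (r ^ 3 * A ^ 4 * C.vertexWeight i) + C.vertexWeight i *
          (C.mean p - C.localMean i p) ^ 2 * (1 / (A * √(C.vertexWeight i) * r ^ 2)) := by
          have := Real.sqrt_pos.2 hi
          field_simp
      _ ≤ _ := by gcongr
  -- The local means spread no more than the coordinates, whose variance is at most dissipation/λ².
  have hvar : ∑ i, C.vertexWeight i * (C.mean p - C.localMean i p) ^ 2 ≤
      (C.dissip fun i => (p i : ℝ)) / C.gap ^ 2 := by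
    refine (C.sum_sq_sub_nbrMean_le hc (fun i => (p i : ℝ)) (C.mean p)).trans ?_
    rw [le_div_iff₀ (by positivity), mul_comm]
    exact C.sq_gap_mul_wvar_le hd hC hu fun i => (p i : ℝ)
  have hsum := Finset.sum_le_sum fun i (_ : i ∈ Finset.univ) => h i
  rw [← Finset.sum_mul, Finset.sum_add_distrib, ← Finset.sum_mul] at hsum
  simp only [Finset.sum_const, Finset.card_univ, Fintype.card_fin, nsmul_eq_mul] at hsum
  calc _ = 2 * (d : ℝ)⁻¹ * ((∑ i, C.vertexWeight i *
        truncDrift (A ^ 2 * C.vertexWeight i) (C.localMean i p)) * y) := by ring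
    _ ≤ 2 * (d : ℝ)⁻¹ * (d * (2 / (r ^ 3 * A ^ 4 * C.beta)) +
        (C.dissip fun i => (p i : ℝ)) / C.gap ^ 2 * (1 / (A * √C.beta * r ^ 2))) := by
        refine mul_le_mul_of_nonneg_left (hsum.trans ?_) (by positivity)
        gcongr
    _ = _ := by field_simp; ring

/-- The expected one-step decrease of the mean is minus the truncation drift, and that drift is
antitone in the local means. -/
lemma monotone_mean_sub_markovOp (A : ℝ) :
    Monotone fun p => C.mean p - markovOp (C.gibbs A) C.mean p := by
  intro p q h
  simp only [C.markovOp_gibbs_mean hc]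
  have : ∑ i, C.vertexWeight i * truncDrift (A ^ 2 * C.vertexWeight i) (C.localMean i q) ≤
      ∑ i, C.vertexWeight i * truncDrift (A ^ 2 * C.vertexWeight i) (C.localMean i p) :=
    Finset.sum_le_sum fun i _ => mul_le_mul_of_nonneg_left
      (truncDrift_antitone _ (C.monotone_localMean hc i h)) (hc i).le
  have := mul_le_mul_of_nonneg_left this (by positivity : (0 : ℝ) ≤ (d : ℝ)⁻¹)
  linarith

end Drift

end Network

/-! ### Elementary bounds for the Wasserstein distance -/

section Wasserstein

variable {d : ℕ} {μ ν : Measure (Fin d → I)}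

lemma isProbabilityMeasure_of_mem_couplings [IsProbabilityMeasure μ]
    {ρ : Measure ((Fin d → I) × (Fin d → I))} (hρ : ρ ∈ couplings μ ν) : IsProbabilityMeasure ρ := by
  refine ⟨?_⟩
  have h : ρ.map Prod.fst Set.univ = 1 := by rw [hρ.1]; exact measure_univ
  rwa [Measure.map_apply measurable_fst MeasurableSet.univ, Set.preimage_univ] at h

lemma bddMeas_dist : BddMeas fun z : (Fin d → I) × (Fin d → I) => dist z.1 z.2 :=
  BddMeas.of_continuous (by fun_prop)

lemma wassersteinInf_le {ρ : Measure ((Fin d → I) × (Fin d → I))} (hρ : ρ ∈ couplings μ ν) :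
    wassersteinInf μ ν ≤ ∫ z, dist z.1 z.2 ∂ρ :=
  csInf_le ⟨0, by rintro _ ⟨ρ, _, rfl⟩; exact integral_nonneg fun z => dist_nonneg⟩ ⟨ρ, hρ, rfl⟩

lemma prod_mem_couplings [IsProbabilityMeasure μ] [IsProbabilityMeasure ν] :
    μ.prod ν ∈ couplings μ ν := by
  refine ⟨?_, ?_⟩
  · change (μ.prod ν).fst = μ; simp
  · change (μ.prod ν).snd = ν; simp

/-- Provides the boundedness that lets individual starting points bound the supremum in `worstDist`
from below. -/
lemma wassersteinInf_le_one [IsProbabilityMeasure μ] [IsProbabilityMeasure ν] :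
    wassersteinInf μ ν ≤ 1 := by
  refine (wassersteinInf_le prod_mem_couplings).trans ?_
  refine (integral_mono (g := fun _ => (1 : ℝ)) (bddMeas_dist.integrable _) (integrable_const _)
    fun z => ?_).trans_eq (by simp)
  refine (dist_pi_le_iff zero_le_one).2 fun i => ?_
  rw [Subtype.dist_eq, Real.dist_eq, abs_le]
  have h1 := (z.1 i).2
  have h2 := (z.2 i).2
  constructor <;> linarith [h1.1, h1.2, h2.1, h2.2]

/-- Testing against a Lipschitz function bounds the Wasserstein distance from below. -/
lemma sub_le_wassersteinInf [IsProbabilityMeasure μ] [IsProbabilityMeasure ν]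
    {f : (Fin d → I) → ℝ} (hf : BddMeas f) (hL : ∀ p q, f p - f q ≤ dist p q) :
    ∫ p, f p ∂μ - ∫ p, f p ∂ν ≤ wassersteinInf μ ν := by
  refine le_csInf ⟨_, _, prod_mem_couplings, rfl⟩ ?_
  rintro _ ⟨ρ, hρ, rfl⟩
  have := isProbabilityMeasure_of_mem_couplings hρ
  rw [← hρ.1, ← hρ.2, integral_map measurable_fst.aemeasurable hf.1.aestronglyMeasurable,
    integral_map measurable_snd.aemeasurable hf.1.aestronglyMeasurable,
    ← integral_sub ((hf.comp measurable_fst).integrable _) ((hf.comp measurable_snd).integrable _)]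
  exact integral_mono (((hf.comp measurable_fst).sub (hf.comp measurable_snd)).integrable _)
    (bddMeas_dist.integrable _) fun z => hL z.1 z.2

end Wasserstein

namespace Network

variable {d : ℕ} (C : Network d)

lemma abs_sub_le_dist (p q : Fin d → I) (i : Fin d) : |(p i : ℝ) - q i| ≤ dist p q :=
  dist_le_pi_dist p q i

lemma mean_sub_mean_le_dist (hu : C.UnitTotalWeight) (p q : Fin d → I) :
    C.mean p - C.mean q ≤ dist p q := by
  have h : ∑ i, C.vertexWeight i * (p i : ℝ) - ∑ i, C.vertexWeight i * (q i : ℝ) ≤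
      ∑ i, C.vertexWeight i * dist p q := by
    rw [← Finset.sum_sub_distrib]
    refine Finset.sum_le_sum fun i _ => ?_
    rw [← mul_sub]
    exact mul_le_mul_of_nonneg_left ((le_abs_self _).trans (abs_sub_le_dist p q i))
      (C.vertexWeight_nonneg i)
  rwa [← Finset.sum_mul, C.sum_vertexWeight hu, one_mul] at h

/-- The error rate produced by the boundary of the cube at margin `r`. -/
noncomputable def boundaryError (b l r A : ℝ) : ℝ :=
  4 / (r ^ 3 * A ^ 2 * b) + 1 / (A * √b * l ^ 2 * r ^ 2)

/-! ### The lower bound -/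

section Bounds

variable [NeZero d] (hd : 2 ≤ d) (hC : C.IsConnected) (hu : C.UnitTotalWeight) {A : ℝ} (hA : 0 < A)
include hd hC hu hA

/-- The Gibbs sampler stays near a constant starting point in the middle of the cube. -/
lemma markovOp_pow_sq_mean_le (herr : boundaryError C.beta C.gap (1 / 8) A ≤ C.beta / 200)
    {a : I} (ha : (a : ℝ) ∈ Set.Icc (1 / 4 : ℝ) (3 / 4)) {δ : ℝ} {k : ℕ}
    (hk : (k : ℝ) ≤ δ ^ 2 / 8 * (C.gap / C.gam) * A ^ 2) :
    markovOp (C.gibbs A ^ k) (fun p => (C.mean p - a) ^ 2) (fun _ => a) ≤ δ ^ 2 := by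
  have hc := C.vertexWeight_pos hd hC
  have hb := C.beta_pos hd hC
  have hg := C.gap_pos hd hC
  have hbg := C.beta_le_gam hd hC hu
  have hgam : 0 < C.gam := hb.trans_le hbg
  have hd0 : (0 : ℝ) < d := Nat.cast_pos.2 (by omega)
  have hsb : 0 < √C.beta := Real.sqrt_pos.2 hb
  -- If S > a then S > 1/4, so a local mean below 1/8 is at least 1/8 away from S; the upper face is
  -- symmetric.
  set r : ℝ := 1 / 8 with hr
  set T : ℝ := 4 / (r ^ 3 * A ^ 4 * C.beta) with hT
  set B : ℝ := 2 / (A * √C.beta * C.gap ^ 2 * r ^ 2) with hB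
  have hB0 : 0 ≤ B := by positivity
  have hTB : A ^ 2 * (T + B / (2 * A ^ 2)) = boundaryError C.beta C.gap r A := by
    rw [hT, hB, boundaryError]; field_simp
  have hinvd : (d : ℝ)⁻¹ ≤ C.gam := by
    rw [inv_le_iff_one_le_mul₀ hd0, mul_comm]
    exact C.one_le_natCast_mul_gam hd hC hu
  have hsq := C.bddMeas_sq_mean_sub (a : ℝ)
  have hen := C.bddMeas_energy.const_mul (B + 2 * C.gam)
  -- The share B of the energy absorbs the dissipation in the truncation drift, and the share 2γ
  -- absorbs the dissipation in the squared jumps.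
  have hdrift : ∀ p, markovOp (C.gibbs A)
      (fun p => (C.mean p - a) ^ 2 + (B + 2 * C.gam) * C.energy p) p ≤
        ((C.mean p - a) ^ 2 + (B + 2 * C.gam) * C.energy p) +
          (T + B / (2 * A ^ 2) + 2 * C.gam / A ^ 2) := by
    intro p
    have hmem := C.mean_mem hu p
    have h1 := C.drift_mul_le hd hC hu hA (r := r) (y := C.mean p - a) (by positivity)
      (by rw [hr]; norm_num) (abs_le.2 ⟨by linarith [ha.2, hmem.1], by linarith [ha.1, hmem.2]⟩) p
      (fun m hm hy => by rw [hr] at *; linarith [ha.1])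
      (fun m hm hy => by rw [hr] at *; linarith [ha.2])
    have h2 := mul_le_mul_of_nonneg_left (C.sum_sq_mul_integral_le hc hu hA
      (C.vertexWeight_le_gam hd hC hu) p) (inv_nonneg.2 hd0.le)
    have h3 := mul_le_mul_of_nonneg_left (C.markovOp_gibbs_energy_le hc hA p)
      (by positivity : 0 ≤ B + 2 * C.gam)
    have h4 : (d : ℝ)⁻¹ * (1 / A ^ 2) ≤ C.gam * (1 / A ^ 2) := by gcongr
    rw [markovOp_add _ hsq hen, markovOp_const_mul, C.markovOp_gibbs_sq_mean hc]
    have e1 : (B + 2 * C.gam) * (C.energy p + 1 / (2 * A ^ 2) -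
        (d : ℝ)⁻¹ * C.dissip fun i => (p i : ℝ)) = (B + 2 * C.gam) * C.energy p +
        B / (2 * A ^ 2) + C.gam * (1 / A ^ 2) -
          B * ((d : ℝ)⁻¹ * C.dissip fun i => (p i : ℝ)) -
            2 * C.gam * ((d : ℝ)⁻¹ * C.dissip fun i => (p i : ℝ)) := by
      field_simp; ring
    have e2 : 2 * C.gam / A ^ 2 = 2 * (C.gam * (1 / A ^ 2)) := by ring
    have e3 : (d : ℝ)⁻¹ * (1 / A ^ 2 + 2 * C.gam * C.dissip fun i => (p i : ℝ)) =
        (d : ℝ)⁻¹ * (1 / A ^ 2) + 2 * C.gam * ((d : ℝ)⁻¹ * C.dissip fun i => (p i : ℝ)) := by ring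
    rw [e1] at h3
    rw [e3] at h2
    rw [← hT, ← hB] at h1
    rw [e2]
    linarith
  have hpow := markovOp_pow_le_of_drift (C.gibbs A) (hsq.add hen) hdrift k (fun _ => a)
  have hle := markovOp_mono (C.gibbs A ^ k) hsq (hsq.add hen) (fun p => le_add_of_nonneg_right
    (mul_nonneg (by positivity) (C.energy_nonneg p))) (fun _ => a)
  rw [C.mean_const hu, C.energy_const, sub_self, mul_zero] at hpow
  have hc0 : 0 ≤ T + B / (2 * A ^ 2) + 2 * C.gam / A ^ 2 := by positivity
  have hfin : (k : ℝ) * (T + B / (2 * A ^ 2) + 2 * C.gam / A ^ 2) ≤ δ ^ 2 := by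
    -- Uses λ ≤ 2 and boundary error ≤ β/200 ≤ 2γ: the constant is (δ²/8)(2/γ)(4γ) = δ².
    calc _ ≤ δ ^ 2 / 8 * (C.gap / C.gam) * A ^ 2 *
          (T + B / (2 * A ^ 2) + 2 * C.gam / A ^ 2) := by gcongr
      _ = δ ^ 2 / 8 * (C.gap / C.gam) * (A ^ 2 * (T + B / (2 * A ^ 2)) + 2 * C.gam) := by
          field_simp
      _ ≤ δ ^ 2 / 8 * (2 / C.gam) * (2 * C.gam + 2 * C.gam) := by
          have := C.gap_le_two hd hC hu
          have h0 : 0 ≤ boundaryError C.beta C.gap r A := by rw [← hTB]; positivity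
          rw [hTB]
          gcongr
          linarith
      _ = δ ^ 2 := by field_simp; ring
  norm_num at hpow
  linarith

lemma abs_markovOp_pow_mean_sub_le (herr : boundaryError C.beta C.gap (1 / 8) A ≤ C.beta / 200)
    {a : I} (ha : (a : ℝ) ∈ Set.Icc (1 / 4 : ℝ) (3 / 4)) {δ : ℝ} (hδ : 0 < δ) {k : ℕ}
    (hk : (k : ℝ) ≤ δ ^ 2 / 8 * (C.gap / C.gam) * A ^ 2) :
    |markovOp (C.gibbs A ^ k) C.mean (fun _ => a) - a| ≤ δ := by
  have h := C.markovOp_pow_sq_mean_le hd hC hu hA herr ha hk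
  have hsq := C.bddMeas_sq_mean_sub (a : ℝ)
  have hbd := hsq.const_mul (1 / (2 * δ))
  have hval : markovOp (C.gibbs A ^ k) (fun p => δ / 2 + 1 / (2 * δ) * (C.mean p - a) ^ 2)
      (fun _ => a) ≤ δ := by
    rw [markovOp_add _ (BddMeas.const _) hbd, markovOp_const, markovOp_const_mul]
    have := mul_le_mul_of_nonneg_left h (by positivity : 0 ≤ 1 / (2 * δ))
    have e : 1 / (2 * δ) * δ ^ 2 = δ / 2 := by field_simp
    linarith
  -- A linear function is dominated by a quadratic one (AM–GM); applied to both signs of S - a, this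
  -- converts the second moment bound into a bound on the expectation.
  have key : ∀ x : ℝ, x ≤ δ / 2 + 1 / (2 * δ) * x ^ 2 := by
    intro x
    have : 0 ≤ (x - δ) ^ 2 / (2 * δ) := by positivity
    have e : (x - δ) ^ 2 / (2 * δ) = δ / 2 + 1 / (2 * δ) * x ^ 2 - x := by field_simp; ring
    linarith
  have hm := C.bddMeas_mean
  rw [abs_le]
  constructor
  · have := markovOp_mono (C.gibbs A ^ k) ((BddMeas.const (a : ℝ)).sub hm)
      ((BddMeas.const (δ / 2)).add hbd) (fun p => by
        have h := key (a - C.mean p)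
        rwa [show ((a : ℝ) - C.mean p) ^ 2 = (C.mean p - a) ^ 2 by ring] at h) (fun _ => a)
    rw [markovOp_sub _ (BddMeas.const _) hm, markovOp_const] at this
    linarith
  · have := markovOp_mono (C.gibbs A ^ k) (hm.sub (BddMeas.const (a : ℝ)))
      ((BddMeas.const _).add hbd) (fun p => key (C.mean p - a)) (fun _ => a)
    rw [markovOp_sub _ hm (BddMeas.const _), markovOp_const] at this
    linarith

/-- Before `(gap / gam) A²` steps the sampler has not mixed: it remembers whether it started at
the level `1/4` or at the level `3/4`. -/
lemma le_worstDist (herr : boundaryError C.beta C.gap (1 / 8) A ≤ C.beta / 200)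
    {δ : ℝ} (hδ : 0 < δ) {k : ℕ} (hk : (k : ℝ) ≤ δ ^ 2 / 8 * (C.gap / C.gam) * A ^ 2) :
    1 / 4 - δ ≤ worstDist C A k := by
  have hπ := C.isProbabilityMeasure_target A
  have hprob : ∀ p, IsProbabilityMeasure (C.gibbsLaw A k p) := fun p =>
    inferInstanceAs (IsProbabilityMeasure ((C.gibbs A ^ k) p))
  have hbdd : BddAbove (Set.range fun p => wassersteinInf (C.gibbsLaw A k p) (C.target A)) :=
    ⟨1, by rintro _ ⟨p, rfl⟩; exact wassersteinInf_le_one⟩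
  set a : I := ⟨1 / 4, by norm_num, by norm_num⟩ with ha
  set b : I := ⟨3 / 4, by norm_num, by norm_num⟩ with hb
  have h1 := le_ciSup hbdd fun _ => a
  have h2 := le_ciSup hbdd fun _ => b
  -- Testing S from the start 3/4 and -S from the start 1/4 cancels the unknown target mean: twice
  -- the worst distance is at least 1/2 - 2δ.
  have h3 := sub_le_wassersteinInf (μ := C.gibbsLaw A k fun _ => b) (ν := C.target A)
    C.bddMeas_mean (C.mean_sub_mean_le_dist hu)
  have h4 := sub_le_wassersteinInf (μ := C.gibbsLaw A k fun _ => a) (ν := C.target A)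
    (C.bddMeas_mean.const_mul (-1)) (fun p q => by
      have := C.mean_sub_mean_le_dist hu q p; rw [dist_comm]; linarith)
  rw [integral_const_mul, integral_const_mul] at h4
  have h5 := C.abs_markovOp_pow_mean_sub_le hd hC hu hA herr (a := a)
    (by rw [ha]; constructor <;> norm_num) hδ hk
  have h6 := C.abs_markovOp_pow_mean_sub_le hd hC hu hA herr (a := b)
    (by rw [hb]; constructor <;> norm_num) hδ hk
  change |∫ p, C.mean p ∂C.gibbsLaw A k (fun _ => a) - 1 / 4| ≤ δ at h5
  change |∫ p, C.mean p ∂C.gibbsLaw A k (fun _ => b) - 3 / 4| ≤ δ at h6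
  rw [abs_le] at h5 h6
  change _ ≤ worstDist C A k at h1
  change _ ≤ worstDist C A k at h2
  linarith [h5.2, h6.1]

end Bounds

/-! ### The monotone coupling -/

section Coupling

variable [NeZero d] (hc : ∀ i, 0 < C.vertexWeight i) (A : ℝ)

/-- Two copies of the Gibbs sampler driven by the same noise. -/
noncomputable def coupledGibbs : Kernel ((Fin d → I) × (Fin d → I)) ((Fin d → I) × (Fin d → I)) :=
  pairKernel (noise d) (C.gibbsMap A) (C.measurable_gibbsMap A)

instance isMarkovKernel_coupledGibbs : IsMarkovKernel (C.coupledGibbs A) :=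
  isMarkovKernel_pairKernel _ _ _

include hc

lemma coupledGibbs_pow_map_fst (k : ℕ) (z : (Fin d → I) × (Fin d → I)) :
    ((C.coupledGibbs A ^ k) z).map Prod.fst = (C.gibbs A ^ k) z.1 := by
  rw [C.gibbs_eq_randomMapKernel hc]
  exact pairKernel_pow_map _ _ _ measurable_fst (fun _ _ => rfl) k z

lemma coupledGibbs_pow_map_snd (k : ℕ) (z : (Fin d → I) × (Fin d → I)) :
    ((C.coupledGibbs A ^ k) z).map Prod.snd = (C.gibbs A ^ k) z.2 := by
  rw [C.gibbs_eq_randomMapKernel hc]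
  exact pairKernel_pow_map _ _ _ measurable_snd (fun _ _ => rfl) k z

lemma markovOp_coupledGibbs_fst {h : (Fin d → I) → ℝ} (hh : BddMeas h) (k : ℕ)
    (z : (Fin d → I) × (Fin d → I)) :
    markovOp (C.coupledGibbs A ^ k) (fun w => h w.1) z = markovOp (C.gibbs A ^ k) h z.1 := by
  rw [markovOp, markovOp, ← C.coupledGibbs_pow_map_fst hc,
    integral_map measurable_fst.aemeasurable hh.1.aestronglyMeasurable]

lemma markovOp_coupledGibbs_snd {h : (Fin d → I) → ℝ} (hh : BddMeas h) (k : ℕ)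
    (z : (Fin d → I) × (Fin d → I)) :
    markovOp (C.coupledGibbs A ^ k) (fun w => h w.2) z = markovOp (C.gibbs A ^ k) h z.2 := by
  rw [markovOp, markovOp, ← C.coupledGibbs_pow_map_snd hc,
    integral_map measurable_snd.aemeasurable hh.1.aestronglyMeasurable]

/-- The coupled distance is largest when started from the two extreme configurations. -/
lemma markovOp_coupledGibbs_dist_le (k : ℕ) (p q : Fin d → I) :
    markovOp (C.coupledGibbs A ^ k) (fun w => dist w.1 w.2) (p, q) ≤
      markovOp (C.coupledGibbs A ^ k) (fun w => dist w.1 w.2) (fun _ => 0, fun _ => 1) := by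
  refine markovOp_randomMapKernel_pow_mono _ _
    (measurable_pairMap (C.gibbsMap A) (C.measurable_gibbsMap A))
    -- Both components of `z` lie between the two components of `w`, a relation preserved by a
    -- monotone map applied to all four configurations.
    (R := fun z w => w.1 ≤ z.1 ∧ z.1 ≤ w.2 ∧ w.1 ≤ z.2 ∧ z.2 ≤ w.2) ?_ bddMeas_dist bddMeas_dist
    ?_ k ⟨fun i => (p i).2.1, fun i => (p i).2.2, fun i => (q i).2.1, fun i => (q i).2.2⟩
  · rintro ω z w ⟨h1, h2, h3, h4⟩
    exact ⟨C.gibbsMap_mono hc A ω h1, C.gibbsMap_mono hc A ω h2, C.gibbsMap_mono hc A ω h3,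
      C.gibbsMap_mono hc A ω h4⟩
  · rintro z w ⟨h1, h2, h3, h4⟩
    refine (dist_pi_le_iff dist_nonneg).2 fun i => ?_
    have h := abs_sub_le_dist w.1 w.2 i
    rw [Subtype.dist_eq, Real.dist_eq, abs_le]
    have e1 : (w.1 i : ℝ) ≤ z.1 i := h1 i
    have e2 : (z.1 i : ℝ) ≤ w.2 i := h2 i
    have e3 : (w.1 i : ℝ) ≤ z.2 i := h3 i
    have e4 : (z.2 i : ℝ) ≤ w.2 i := h4 i
    have e5 := abs_le.1 h
    constructor <;> linarith [e5.1]

/-- The coupling never leaves the set of ordered pairs, so an inequality need only be known there.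
-/
lemma markovOp_coupledGibbs_le_of_ordered {h g : (Fin d → I) × (Fin d → I) → ℝ} (hh : BddMeas h)
    (hg : BddMeas g) (hle : ∀ z : (Fin d → I) × (Fin d → I), z.1 ≤ z.2 → h z ≤ g z) (k : ℕ)
    {z : (Fin d → I) × (Fin d → I)} (hz : z.1 ≤ z.2) :
    markovOp (C.coupledGibbs A ^ k) h z ≤ markovOp (C.coupledGibbs A ^ k) g z := by
  refine markovOp_randomMapKernel_pow_mono _ _
    (measurable_pairMap (C.gibbsMap A) (C.measurable_gibbsMap A))
    (R := fun z w => z = w ∧ z.1 ≤ z.2) ?_ hh hg ?_ k ⟨rfl, hz⟩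
  · rintro ω z _ ⟨rfl, h⟩
    exact ⟨rfl, C.gibbsMap_mono hc A ω h⟩
  · rintro z _ ⟨rfl, h⟩
    exact hle z h

/-- The distance to equilibrium is controlled by the coupling of the two extreme starting points. -/
lemma wassersteinInf_gibbsLaw_le (k : ℕ) (p : Fin d → I) :
    wassersteinInf (C.gibbsLaw A k p) (C.target A) ≤
      markovOp (C.coupledGibbs A ^ k) (fun w => dist w.1 w.2) (fun _ => 0, fun _ => 1) := by
  have hπ := C.isProbabilityMeasure_target A
  -- The second chain starts from the target and keeps that law by invariance; ρ is the joint law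
  -- after k steps.
  set η : Kernel (Fin d → I) ((Fin d → I) × (Fin d → I)) :=
    (C.coupledGibbs A ^ k).comap (fun q => (p, q)) measurable_prodMk_left with hη
  set ρ : Measure ((Fin d → I) × (Fin d → I)) :=
    (η ∘ₖ Kernel.const Unit (C.target A)) () with hρ
  have happ : ∀ {s : Set ((Fin d → I) × (Fin d → I))}, MeasurableSet s →
      ρ s = ∫⁻ q, (C.coupledGibbs A ^ k) (p, q) s ∂C.target A := by
    intro s hs
    rw [hρ, Kernel.comp_apply' _ _ _ hs, Kernel.const_apply]
    rfl
  have hmem : ρ ∈ couplings (C.gibbsLaw A k p) (C.target A) := by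
    constructor
    · ext s hs
      rw [Measure.map_apply measurable_fst hs, happ (measurable_fst hs)]
      have : ∀ q, (C.coupledGibbs A ^ k) (p, q) (Prod.fst ⁻¹' s) = C.gibbsLaw A k p s := fun q => by
        rw [← Measure.map_apply measurable_fst hs, C.coupledGibbs_pow_map_fst hc]; rfl
      simp [this]
    · ext s hs
      rw [Measure.map_apply measurable_snd hs, happ (measurable_snd hs)]
      have : ∀ q, (C.coupledGibbs A ^ k) (p, q) (Prod.snd ⁻¹' s) = (C.gibbs A ^ k) q s := fun q => by
        rw [← Measure.map_apply measurable_snd hs, C.coupledGibbs_pow_map_snd hc]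
      simp only [this]
      rw [← Measure.bind_apply hs (Kernel.aemeasurable _), (C.gibbs_pow_invariant A k).def]
  refine (wassersteinInf_le hmem).trans ?_
  rw [hρ, Kernel.integral_comp (bddMeas_dist.integrable _), Kernel.const_apply]
  have hbm : BddMeas fun q => ∫ z, dist z.1 z.2 ∂η q :=
    (bddMeas_dist.markovOp (κ := C.coupledGibbs A ^ k)).comp measurable_prodMk_left
  refine (integral_mono (hbm.integrable _) (integrable_const _)
    fun q => C.markovOp_coupledGibbs_dist_le hc A k p q).trans_eq ?_
  simp

end Coupling

/-! ### The upper bound -/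

section Upper

variable [NeZero d] (hd : 2 ≤ d) (hC : C.IsConnected) (hu : C.UnitTotalWeight) {A : ℝ} (hA : 0 < A)
include hd hC hu

omit [NeZero d] in
/-- A configuration of small energy is nearly constant. -/
lemma abs_sub_mean_le {η : ℝ} (hη : 0 < η) (p : Fin d → I) (i : Fin d) :
    |(p i : ℝ) - C.mean p| ≤ η / 2 + C.energy p / (2 * η * C.beta * C.gap) := by
  have hb := C.beta_pos hd hC
  have hg := C.gap_pos hd hC
  have h1 : C.beta * ((p i : ℝ) - C.mean p) ^ 2 ≤ C.wvar fun j => (p j : ℝ) :=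
    (mul_le_mul_of_nonneg_right (C.beta_le i) (sq_nonneg _)).trans
      (Finset.single_le_sum (f := fun i => C.vertexWeight i * ((p i : ℝ) - C.mean p) ^ 2)
        (fun j _ => mul_nonneg (C.vertexWeight_nonneg j) (sq_nonneg _)) (Finset.mem_univ i))
  have h2 := C.gap_mul_wvar_le hd hC hu fun j => (p j : ℝ)
  rw [← energy_eq] at h2
  have h3 : ((p i : ℝ) - C.mean p) ^ 2 ≤ C.energy p / (C.beta * C.gap) := by
    rw [le_div_iff₀ (by positivity)]
    nlinarith
  -- AM–GM replaces a square root by a bound linear in the energy, which can later be averaged over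
  -- the chain.
  have h4 : 0 ≤ (|(p i : ℝ) - C.mean p| - η) ^ 2 / (2 * η) := by positivity
  have h5 : (|(p i : ℝ) - C.mean p| - η) ^ 2 / (2 * η) =
      η / 2 + ((p i : ℝ) - C.mean p) ^ 2 / (2 * η) - |(p i : ℝ) - C.mean p| := by
    rw [← sq_abs ((p i : ℝ) - C.mean p)]; field_simp; ring
  have h6 : ((p i : ℝ) - C.mean p) ^ 2 / (2 * η) ≤ C.energy p / (2 * η * C.beta * C.gap) := by
    have : C.energy p / (2 * η * C.beta * C.gap) = C.energy p / (C.beta * C.gap) / (2 * η) := by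
      field_simp
    rw [this]
    gcongr
  linarith

omit [NeZero d] in
lemma dist_le_mean_sub_add {η : ℝ} (hη : 0 < η) {p q : Fin d → I} (hpq : p ≤ q) :
    dist p q ≤ (C.mean q - C.mean p) +
      (η + 1 / (2 * η * C.beta * C.gap) * (C.energy p + C.energy q)) := by
  have hb := C.beta_pos hd hC
  have hg := C.gap_pos hd hC
  have hm : 0 ≤ C.mean q - C.mean p := sub_nonneg.2 (C.monotone_mean hpq)
  have e1 := C.energy_nonneg p
  have e2 := C.energy_nonneg q
  refine (dist_pi_le_iff (by positivity)).2 fun i => ?_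
  have h1 := abs_le.1 (C.abs_sub_mean_le hd hC hu hη p i)
  have h2 := abs_le.1 (C.abs_sub_mean_le hd hC hu hη q i)
  have e : 1 / (2 * η * C.beta * C.gap) * (C.energy p + C.energy q) =
    C.energy p / (2 * η * C.beta * C.gap) + C.energy q / (2 * η * C.beta * C.gap) := by ring
  rw [Subtype.dist_eq, Real.dist_eq, e, abs_le]
  constructor <;> linarith [h1.1, h1.2, h2.1, h2.2]

include hA

/-- The expected energy contracts by 1 - λ/d per step with source 1/(2A²); the bound is the fixed
point of this recursion, and the chain starts below it, at energy 0. -/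
lemma markovOp_pow_energy_const_le (k : ℕ) (a : I) :
    markovOp (C.gibbs A ^ k) C.energy (fun _ => a) ≤ d / (2 * A ^ 2 * C.gap) := by
  have hc := C.vertexWeight_pos hd hC
  have hg := C.gap_pos hd hC
  have hd2 : (2 : ℝ) ≤ d := by exact_mod_cast hd
  have hd0 : (0 : ℝ) < d := by linarith
  refine markovOp_pow_le_of_contraction (C.gibbs A) (a := 1 - C.gap / d) (c := 1 / (2 * A ^ 2))
    C.bddMeas_energy ?_ ?_ ?_ k _ (by rw [energy_const]; positivity)
  · have := C.gap_le_two hd hC hu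
    rw [sub_nonneg, div_le_one hd0]
    linarith
  · refine le_of_eq ?_
    field_simp
    ring
  · intro p
    refine (C.markovOp_gibbs_energy_le hc hA p).trans ?_
    have h := mul_le_mul_of_nonneg_left (C.gap_mul_dirichlet_le hd hC hu fun i => (p i : ℝ))
      (inv_nonneg.2 hd0.le)
    rw [← energy_eq] at h
    have e : (1 - C.gap / d) * C.energy p = C.energy p - (d : ℝ)⁻¹ * (C.gap * C.energy p) := by
      field_simp
    rw [e]
    linarith

omit hC hu hA hd in
/-- The gap between the means of two ordered starting points is nonincreasing in time. -/
lemma monotone_markovOp_pow_mean_sub (hc : ∀ i, 0 < C.vertexWeight i) (A : ℝ) (t : ℕ) :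
    Monotone fun p => markovOp (C.gibbs A ^ t) C.mean p - markovOp (C.gibbs A ^ (t + 1)) C.mean p := by
  have hm := C.bddMeas_mean
  have h : (fun p => markovOp (C.gibbs A ^ t) C.mean p - markovOp (C.gibbs A ^ (t + 1)) C.mean p) =
      markovOp (C.gibbs A ^ t) fun p => C.mean p - markovOp (C.gibbs A) C.mean p := by
    funext p
    rw [markovOp_sub _ hm hm.markovOp, markovOp_pow_succ' _ hm]
  rw [h]
  exact C.markovOp_gibbs_pow_monotone hc A (hm.sub hm.markovOp) (C.monotone_mean_sub_markovOp hc A) t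

/-- The mean distance, at time `t`, between the top chain and the chain started at `p`. -/
noncomputable def topGap (A : ℝ) (t : ℕ) (p : Fin d → I) : ℝ :=
  markovOp (C.gibbs A ^ t) C.mean (fun _ => 1) - markovOp (C.gibbs A ^ t) C.mean p

omit hC hu hA hd in
lemma antitone_topGap (hc : ∀ i, 0 < C.vertexWeight i) (A : ℝ) (p : Fin d → I) :
    Antitone fun t => C.topGap A t p := by
  refine antitone_nat_of_succ_le fun t => ?_
  have h := C.monotone_markovOp_pow_mean_sub hc A t
    (show p ≤ fun _ => 1 from fun i => (p i).2.2)
  simp only [topGap] at *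
  linarith

omit [NeZero d] hd hC hA in
lemma topGap_zero (A : ℝ) (p : Fin d → I) : C.topGap A 0 p = 1 - C.mean p := by
  rw [topGap, markovOp_pow_zero _ C.bddMeas_mean, C.mean_const hu]
  simp

omit hd hC hu hA in
lemma bddMeas_topGap (A : ℝ) (t : ℕ) : BddMeas (C.topGap A t) :=
  (BddMeas.const _).sub C.bddMeas_mean.markovOp

omit hd hC hu hA in
-- The Markov property handles the lower chain. Restarting the top chain from all ones after one
-- step can only raise its mean, by monotonicity.
lemma topGap_succ_le (hc : ∀ i, 0 < C.vertexWeight i) (A : ℝ) (t : ℕ) (p : Fin d → I) :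
    C.topGap A (t + 1) p ≤ markovOp (C.gibbs A) (C.topGap A t) p := by
  have hm := C.bddMeas_mean
  have h1 : markovOp (C.gibbs A ^ (t + 1)) C.mean (fun _ => 1) ≤
      markovOp (C.gibbs A ^ t) C.mean (fun _ => 1) := by
    rw [markovOp_pow_succ _ hm]
    refine (markovOp_mono _ hm.markovOp (BddMeas.const _) (fun q =>
      C.markovOp_gibbs_pow_monotone hc A hm C.monotone_mean t
        (show q ≤ fun _ => 1 from fun i => (q i).2.2)) _).trans_eq ?_
    rw [markovOp_const]
  have h2 : markovOp (C.gibbs A) (C.topGap A t) p = markovOp (C.gibbs A ^ t) C.mean (fun _ => 1) -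
      markovOp (C.gibbs A) (markovOp (C.gibbs A ^ t) C.mean) p := by
    unfold topGap
    rw [markovOp_sub _ (BddMeas.const _) hm.markovOp, markovOp_const]
  have h3 := congrFun (markovOp_pow_succ (C.gibbs A) hm t) p
  rw [h2, topGap]
  linarith

/-- The top chain and the bottom chain merge once the bottom chain reaches the upper boundary,
which its fluctuations force within `O(d A²)` steps. -/
lemma sum_topGap_le {ε : ℝ} (hε : 0 < ε) (h4 : 4 ≤ A ^ 2 * C.beta)
    (herr : boundaryError C.beta C.gap (ε / 2) A ≤ C.beta / 200) (k : ℕ) :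
    ∑ t ∈ Finset.range k, C.topGap A t (fun _ => 0) ≤ k * ε + 200 * d * A ^ 2 := by
  have hc := C.vertexWeight_pos hd hC
  have hb := C.beta_pos hd hC
  have hg := C.gap_pos hd hC
  have hd0 : (0 : ℝ) < d := Nat.cast_pos.2 (by omega)
  have hsb : 0 < √C.beta := Real.sqrt_pos.2 hb
  set r : ℝ := ε / 2 with hr
  have hr0 : 0 < r := by positivity
  set T : ℝ := 4 / (r ^ 3 * A ^ 4 * C.beta) with hT
  set B : ℝ := 2 / (A * √C.beta * C.gap ^ 2 * r ^ 2) with hB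
  have hB0 : 0 ≤ B := by positivity
  have hTB : T + B / (2 * A ^ 2) = boundaryError C.beta C.gap r A / A ^ 2 := by
    rw [hT, hB, boundaryError]; field_simp
  have hbd : C.beta ≤ (d : ℝ)⁻¹ := by
    rw [le_inv_comm₀ hb hd0, ← one_div, le_div_iff₀ hb]
    exact C.natCast_mul_beta_le hu
  have hTB' : T + B / (2 * A ^ 2) ≤ 1 / (200 * d * A ^ 2) := by
    rw [hTB]
    calc _ ≤ (d : ℝ)⁻¹ / 200 / A ^ 2 := by gcongr; exact herr.trans (by gcongr)
      _ = _ := by field_simp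
  -- A potential that decreases while S < 1 - ε: the fluctuations push S² up, and the energy term
  -- absorbs the dissipation in the truncation drift.
  set w : (Fin d → I) → ℝ := fun p => (1 - (C.mean p - 0) ^ 2) + B * C.energy p with hw
  have hsq := C.bddMeas_sq_mean_sub 0
  have hsq1 := (BddMeas.const (1 : ℝ)).sub hsq
  have hen := C.bddMeas_energy.const_mul B
  have hwm : BddMeas w := hsq1.add hen
  have hw0 : ∀ p, 0 ≤ w p := by
    intro p
    have h1 := C.mean_mem hu p
    have h2 := mul_nonneg hB0 (C.energy_nonneg p)
    simp only [hw]
    nlinarith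
  have hdrift : ∀ p, C.mean p < 1 - ε →
      markovOp (C.gibbs A) w p ≤ w p - 1 / (200 * d * A ^ 2) := by
    intro p hp
    have hmem := C.mean_mem hu p
    -- With y = -S ≤ 0 only the upper face matters: a local mean above 1 - ε/2 exceeds S < 1 - ε by
    -- at least r = ε/2.
    have h1 := C.drift_mul_le hd hC hu hA (r := r) (y := -C.mean p) hr0 (by linarith)
      (abs_le.2 ⟨by linarith, by linarith⟩) p
      (fun m hm hy => by linarith) (fun m hm hy => by linarith)
    have h2 := mul_le_mul_of_nonneg_left (C.le_sum_sq_mul_integral hc hu hA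
      (fun i => h4.trans (mul_le_mul_of_nonneg_left (C.beta_le i) (sq_nonneg A))) p)
        (inv_nonneg.2 hd0.le)
    have h3 := mul_le_mul_of_nonneg_left (C.markovOp_gibbs_energy_le hc hA p) hB0
    have e1 : B * (C.energy p + 1 / (2 * A ^ 2) - (d : ℝ)⁻¹ * C.dissip fun i => (p i : ℝ)) =
        B * C.energy p + B / (2 * A ^ 2) - B * ((d : ℝ)⁻¹ * C.dissip fun i => (p i : ℝ)) := by
      ring
    -- The fluctuation gain is twice 1/(200dA²): one half pays for T + B/(2A²), the other is the net
    -- decrease.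
    have e2 : (d : ℝ)⁻¹ * (1 / (100 * A ^ 2)) = 2 * (1 / (200 * d * A ^ 2)) := by
      field_simp; norm_num
    rw [← hT, ← hB] at h1
    rw [e1] at h3
    rw [e2] at h2
    rw [hw, markovOp_add _ hsq1 hen, markovOp_sub _ (BddMeas.const _) hsq, markovOp_const,
      markovOp_const_mul, C.markovOp_gibbs_sq_mean hc]
    simp only [sub_zero]
    linarith
  have hc0 : (0 : ℝ) < 200 * d * A ^ 2 := by positivity
  -- Induction on the horizon for all starting points at once. Below 1 - ε, the decrease of the
  -- potential pays for the first term, which is at most 1. Above, every term is at most ε, because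
  -- the gap starts below ε and is nonincreasing in time.
  have main : ∀ k : ℕ, ∀ p, ∑ t ∈ Finset.range k, C.topGap A t p ≤
      k * ε + 200 * d * A ^ 2 * w p := by
    intro k
    induction k with
    | zero => intro p; simpa using mul_nonneg hc0.le (hw0 p)
    | succ k ih =>
      intro p
      have hwp := mul_nonneg hc0.le (hw0 p)
      rcases lt_or_ge (C.mean p) (1 - ε) with hp | hp
      · rw [Finset.sum_range_succ', C.topGap_zero hu]
        have h1 : ∑ t ∈ Finset.range k, C.topGap A (t + 1) p ≤
            markovOp (C.gibbs A) (fun q => ∑ t ∈ Finset.range k, C.topGap A t q) p := by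
          rw [markovOp, integral_finsetSum _ fun t _ => (C.bddMeas_topGap A t).integrable _]
          exact Finset.sum_le_sum fun t _ => C.topGap_succ_le hc A t p
        have h2 := markovOp_mono (C.gibbs A) (BddMeas.sum _ fun t => C.bddMeas_topGap A t)
          ((BddMeas.const _).add (hwm.const_mul _)) ih p
        rw [markovOp_add _ (BddMeas.const _) (hwm.const_mul _), markovOp_const,
          markovOp_const_mul] at h2
        have h3 := mul_le_mul_of_nonneg_left (hdrift p hp) hc0.le
        have e : 200 * d * A ^ 2 * (w p - 1 / (200 * d * A ^ 2)) = 200 * d * A ^ 2 * w p - 1 := by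
          field_simp
        rw [e] at h3
        have h5 := (C.mean_mem hu p).1
        push_cast
        linarith
      · have h1 : ∀ t ∈ Finset.range (k + 1), C.topGap A t p ≤ ε := by
          intro t _
          have := C.antitone_topGap hc A p (Nat.zero_le t)
          simp only [C.topGap_zero hu] at this
          linarith
        have h2 := Finset.sum_le_sum h1
        rw [Finset.sum_const, Finset.card_range, nsmul_eq_mul] at h2
        linarith
  have h := main k fun _ => 0
  have hwz : w (fun _ => 0) = 1 := by
    simp only [hw]
    rw [C.mean_const hu, C.energy_const]
    simp
  rwa [hwz, mul_one] at h

lemma worstDist_le {ε : ℝ} (hε : 0 < ε) (h4 : 4 ≤ A ^ 2 * C.beta)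
    (herr : boundaryError C.beta C.gap (ε / 2) A ≤ C.beta / 200)
    (hflat : 1 / (2 * ε * C.beta ^ 2 * C.gap ^ 2 * A ^ 2) ≤ ε) {k : ℕ}
    (hk : 200 / ε * d * A ^ 2 ≤ k) : worstDist C A k ≤ 4 * ε := by
  have hc := C.vertexWeight_pos hd hC
  have hb := C.beta_pos hd hC
  have hg := C.gap_pos hd hC
  have hd0 : (0 : ℝ) < d := Nat.cast_pos.2 (by omega)
  have hk0 : (0 : ℝ) < k := lt_of_lt_of_le (by positivity) hk
  -- The last term of a nonincreasing sequence is at most its average. The total 4ε is this 2ε, plus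
  -- ε from the comparison of distance and means, plus ε from the expected energies.
  have hgap : C.topGap A k (fun _ => 0) ≤ 2 * ε := by
    have h1 := C.sum_topGap_le hd hC hu hA hε h4 herr k
    have h2 : ∑ t ∈ Finset.range k, C.topGap A k (fun _ => 0) ≤
        ∑ t ∈ Finset.range k, C.topGap A t (fun _ => 0) :=
      Finset.sum_le_sum fun t ht => C.antitone_topGap hc A _ (Finset.mem_range.1 ht).le
    rw [Finset.sum_const, Finset.card_range, nsmul_eq_mul] at h2
    have h3 : 200 * d * A ^ 2 ≤ k * ε := by
      have := mul_le_mul_of_nonneg_right hk hε.le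
      have e : 200 / ε * d * A ^ 2 * ε = 200 * d * A ^ 2 := by field_simp
      linarith
    refine le_of_mul_le_mul_left ?_ hk0
    linarith
  set K : ℝ := 1 / (2 * ε * C.beta * C.gap) with hK
  have hm := C.bddMeas_mean
  have hen := C.bddMeas_energy
  have b1 : BddMeas fun z : (Fin d → I) × (Fin d → I) => C.mean z.2 - C.mean z.1 :=
    (hm.comp measurable_snd).sub (hm.comp measurable_fst)
  have b2 : BddMeas fun z : (Fin d → I) × (Fin d → I) => C.energy z.1 + C.energy z.2 :=
    (hen.comp measurable_fst).add (hen.comp measurable_snd)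
  have b3 : BddMeas fun z : (Fin d → I) × (Fin d → I) =>
      ε + K * (C.energy z.1 + C.energy z.2) := (BddMeas.const _).add (b2.const_mul _)
  have hdist : markovOp (C.coupledGibbs A ^ k) (fun w => dist w.1 w.2) (fun _ => 0, fun _ => 1) ≤
      4 * ε := by
    refine (C.markovOp_coupledGibbs_le_of_ordered hc A bddMeas_dist (b1.add b3)
      (fun z hz => C.dist_le_mean_sub_add hd hC hu hε hz) k
        (show (fun _ => (0 : I)) ≤ (fun _ : Fin d => (1 : I)) from fun _ => zero_le_one)).trans ?_
    rw [markovOp_add _ b1 b3, markovOp_sub _ (hm.comp measurable_snd) (hm.comp measurable_fst),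
      markovOp_add _ (BddMeas.const _) (b2.const_mul _), markovOp_const, markovOp_const_mul,
      markovOp_add _ (hen.comp measurable_fst) (hen.comp measurable_snd),
      C.markovOp_coupledGibbs_fst hc A hm, C.markovOp_coupledGibbs_snd hc A hm,
      C.markovOp_coupledGibbs_fst hc A hen, C.markovOp_coupledGibbs_snd hc A hen]
    have e0 := C.markovOp_pow_energy_const_le hd hC hu hA k 0
    have e1 := C.markovOp_pow_energy_const_le hd hC hu hA k 1
    have e2 : K * (markovOp (C.gibbs A ^ k) C.energy (fun _ => 0) +
        markovOp (C.gibbs A ^ k) C.energy (fun _ => 1)) ≤ ε := by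
      -- The dimension disappears through dβ ≤ 1, so the condition on A involves only ε, β and λ.
      have hKd : K * (d / (2 * A ^ 2 * C.gap) + d / (2 * A ^ 2 * C.gap)) =
          (d * C.beta) * (1 / (2 * ε * C.beta ^ 2 * C.gap ^ 2 * A ^ 2)) := by
        rw [hK]; field_simp; norm_num
      calc _ ≤ K * (d / (2 * A ^ 2 * C.gap) + d / (2 * A ^ 2 * C.gap)) := by gcongr
        _ = _ := hKd
        _ ≤ 1 * (1 / (2 * ε * C.beta ^ 2 * C.gap ^ 2 * A ^ 2)) := by
            gcongr
            exact C.natCast_mul_beta_le hu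
        _ ≤ ε := by rwa [one_mul]
    change C.topGap A k (fun _ => 0) + _ ≤ _
    linarith
  exact ciSup_le fun p => (C.wassersteinInf_gibbsLaw_le hc A k p).trans hdist

end Upper

/-! ### The threshold and the final assembly -/

/-- All smallness conditions on `A` hold beyond a threshold depending only on `δ`, `β`, `λ`. -/
lemma exists_threshold {b ε : ℝ} (l : ℝ) (hb : 0 < b) (hε : 0 < ε) :
    ∃ A₀ : ℝ, ∀ A, A₀ ≤ A → 4 ≤ A ^ 2 * b ∧ boundaryError b l (1 / 8) A ≤ b / 200 ∧
      boundaryError b l (ε / 2) A ≤ b / 200 ∧ 1 / (2 * ε * b ^ 2 * l ^ 2 * A ^ 2) ≤ ε := by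
  have hsb : 0 < √b := Real.sqrt_pos.2 hb
  have hsq : Filter.Tendsto (fun A : ℝ => A ^ 2) Filter.atTop Filter.atTop :=
    Filter.tendsto_pow_atTop two_ne_zero
  have herr : ∀ r : ℝ, 0 < r → ∀ᶠ A in Filter.atTop, boundaryError b l r A ≤ b / 200 := by
    intro r hr
    have h1 : Filter.Tendsto (fun A : ℝ => 4 / (r ^ 3 * b) / A ^ 2 +
        1 / (√b * l ^ 2 * r ^ 2) / A) Filter.atTop (nhds (0 + 0)) :=
      (hsq.const_div_atTop _).add (Filter.tendsto_id.const_div_atTop _)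
    rw [add_zero] at h1
    filter_upwards [h1.eventually_le_const (by positivity : 0 < b / 200)] with A hA
    refine le_trans (le_of_eq ?_) hA
    rw [boundaryError, div_div, div_div]
    congr 2 <;> ring
  have h1 : ∀ᶠ A : ℝ in Filter.atTop, 4 ≤ A ^ 2 * b :=
    (hsq.atTop_mul_const hb).eventually_ge_atTop 4
  have h2 : ∀ᶠ A : ℝ in Filter.atTop, 1 / (2 * ε * b ^ 2 * l ^ 2 * A ^ 2) ≤ ε := by
    have h : Filter.Tendsto (fun A : ℝ => 1 / (2 * ε * b ^ 2 * l ^ 2) / A ^ 2) Filter.atTop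
      (nhds 0) := hsq.const_div_atTop _
    filter_upwards [h.eventually_le_const hε] with A hA
    rwa [div_div] at hA
  exact Filter.eventually_atTop.1 (h1.and ((herr _ (by norm_num)).and
    ((herr _ (by positivity)).and h2)))

end Network

end GibbsNetwork

theorem theorem2p1 :
    ∃ (m M : ℝ → ℝ) (Astar : ℝ → ℝ → ℝ → ℝ),
      (∀ δ : ℝ, 0 < δ → 0 < m δ ∧ 0 < M δ) ∧
      ∀ (δ : ℝ), 0 < δ →
      ∀ (d : ℕ), 2 ≤ d →
      ∀ (C : GibbsNetwork.Network d), C.IsConnected → C.UnitTotalWeight →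
      ∀ (A : ℝ), 0 < A → Astar δ C.beta C.gap ≤ A →
        (∀ k : ℕ, (k : ℝ) ≤ m δ * (C.gap / C.gam) * A ^ 2 →
          1 / 4 - δ ≤ GibbsNetwork.worstDist C A k) ∧
        (∀ k : ℕ, M δ * d * A ^ 2 ≤ (k : ℝ) →
          GibbsNetwork.worstDist C A k ≤ δ) := by
  -- The threshold is chosen before the network, as a function of δ, β, λ alone. The margin min(δ,
  -- 1)/4 makes the bound 4ε at most δ; where δ or b is not positive, 0 serves as an arbitrary
  -- value.
  have hthr : ∀ δ b l : ℝ, ∃ A₀ : ℝ, 0 < δ → 0 < b → ∀ A, A₀ ≤ A → 4 ≤ A ^ 2 * b ∧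
      GibbsNetwork.Network.boundaryError b l (1 / 8) A ≤ b / 200 ∧
      GibbsNetwork.Network.boundaryError b l (min δ 1 / 4 / 2) A ≤ b / 200 ∧
      1 / (2 * (min δ 1 / 4) * b ^ 2 * l ^ 2 * A ^ 2) ≤ min δ 1 / 4 := by
    intro δ b l
    by_cases h : 0 < δ ∧ 0 < b
    · have hε : 0 < min δ 1 / 4 := by have := lt_min h.1 one_pos; positivity
      obtain ⟨A₀, hA₀⟩ := GibbsNetwork.Network.exists_threshold l h.2 hε
      exact ⟨A₀, fun _ _ => hA₀⟩
    · exact ⟨0, fun h1 h2 => absurd ⟨h1, h2⟩ h⟩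
  choose Astar hAstar using hthr
  refine ⟨fun δ => δ ^ 2 / 8, fun δ => 200 / (min δ 1 / 4), Astar, fun δ hδ => ?_, ?_⟩
  · have := lt_min hδ one_pos
    constructor <;> positivity
  intro δ hδ d hd C hC hu A hA hAA
  have : NeZero d := ⟨by omega⟩
  have hε : 0 < min δ 1 / 4 := by have := lt_min hδ one_pos; positivity
  obtain ⟨h4, herr1, herr2, hflat⟩ :=
    hAstar δ C.beta C.gap hδ (C.beta_pos hd hC) A hAA
  refine ⟨fun k hk => C.le_worstDist hd hC hu hA herr1 hδ hk, fun k hk => ?_⟩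
  refine (C.worstDist_le hd hC hu hA hε h4 herr2 hflat hk).trans ?_
  linarith [min_le_left δ 1]
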